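/- For a finite abelian group $G$ of order $N$ and a set $A \subset G$, let $\Gamma_A$ be the Cayley sum graph of $A$: the graph with vertex set $G$ in which distinct $x,y$ are joined if and only if $x+y \in A$. Write $\chi$ for the chromatic number, and for $X \subset G$ write $X \hat{+} X = \{x+x' : x,x' \in X,\ x \neq x'\}$. Let $\varepsilon > 0$. Let $A$ be chosen uniformly at random from all $2^N$ subsets of $G$. Then, as $N \to \infty$ with $(N,6)=1$, uniformly over all abelian groups $G$ of order $N$, $$\mathbb{P}\Big(\chi(\Gamma_A) \le (1+\varepsilon)\frac{N}{2\log_2 N}\Big) \to 1.$$ That is, for every $\delta > 0$ there is $N_0 = N_0(\varepsilon,\delta)$ such that this probability is at least $1-\delta$ for every abelian group $G$ of order $N \ge N_0$ with $(N,6)=1$. Equivalently, in arithmetic form: with $r = \big\lfloor (1+\varepsilon)\frac{N}{2\log_2 N} \big\rfloor$, in the same sense, with probability tending to $1$ there is a partition $G = X_1 \cup \dots \cup X_r$ into $r$ nonempty sets such that $X_i \hat{+} X_i \subset A$ for all $i$. -/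

import Mathlib

/-- The Cayley sum graph of `A ⊆ G`: distinct `x, y` are joined iff `x + y ∈ A`. -/
def cayleySumGraph {G : Type*} [AddCommGroup G] (A : Set G) : SimpleGraph G where
  Adj x y := x ≠ y ∧ x + y ∈ A
  symm := ⟨fun x y h => ⟨h.1.symm, by rw [add_comm]; exact h.2⟩⟩
  loopless := ⟨fun _ h => h.1 rfl⟩

/-- The restricted sumset `{x + x' : x, x' ∈ X, x ≠ x'}`. -/
def restrictedSumset {G : Type*} [AddCommGroup G] (X : Set G) : Set G :=
  {z | ∃ x ∈ X, ∃ x' ∈ X, x ≠ x' ∧ x + x' = z}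

/-- The probability of an event `E` for a subset of the finite set `G` chosen uniformly among
all subsets of `G`. -/
noncomputable def randomSubsetProb {G : Type*} [Fintype G] (E : Set (Set G)) : ℝ :=
  ((PMF.uniformOfFintype (Set G)).toOuterMeasure E).toReal

/-- `X₀, …, X_{r-1}` is a partition of `G` into `r` nonempty, pairwise disjoint sets. -/
structure IsPartitionInto {G : Type*} (r : ℕ) (X : Fin r → Set G) : Prop where
  nonempty : ∀ i, (X i).Nonempty
  disjoint : ∀ i j, i ≠ j → Disjoint (X i) (X j)
  cover : ⋃ i, X i = Set.univ

open Finset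

/-- Averaging a function that ignores the elements of `D` over the sets containing `D`. -/
theorem two_pow_mul_sum_superset {G : Type*} [Fintype G] [DecidableEq G] (D : Finset G)
    (g : Finset G → ℝ) (hg : ∀ a ∈ D, ∀ A, g (insert a A) = g A) :
    2 ^ #D * ∑ A, (if D ⊆ A then g A else 0) = ∑ A, g A := by
  induction D using Finset.induction_on with
  | empty => simp
  | insert a D ha ih =>
    rw [← ih fun b hb => hg b (mem_insert_of_mem hb), card_insert_of_notMem ha, pow_succ, mul_assoc]
    congr 1
    have h1 : ∑ A, (if D ⊆ A then g A else 0) =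
        ∑ A, (if insert a D ⊆ A then g A else 0) +
          ∑ A, (if D ⊆ A ∧ a ∉ A then g A else 0) := by
      rw [← sum_add_distrib]
      refine sum_congr rfl fun A _ => ?_
      by_cases h : a ∈ A <;> by_cases h' : D ⊆ A <;> simp [insert_subset_iff, h, h']
    have h2 : ∑ A, (if insert a D ⊆ A then g A else 0) =
        ∑ A, (if D ⊆ A ∧ a ∉ A then g A else 0) := by
      rw [← sum_filter, ← sum_filter]
      refine sum_bij' (fun A _ => A.erase a) (fun A _ => insert a A) ?_ ?_ ?_ ?_ ?_
      · intro A hA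
        simp only [mem_filter, mem_univ, true_and, insert_subset_iff] at hA ⊢
        exact ⟨subset_erase.2 ⟨hA.2, ha⟩, notMem_erase a A⟩
      · intro A hA
        simp only [mem_filter, mem_univ, true_and] at hA ⊢
        exact insert_subset_insert a hA.1
      · intro A hA
        simp only [mem_filter, mem_univ, true_and, insert_subset_iff] at hA
        exact insert_erase hA.1
      · intro A hA
        simp only [mem_filter, mem_univ, true_and] at hA
        exact erase_insert hA.2
      · intro A hA
        simp only [mem_filter, mem_univ, true_and, insert_subset_iff] at hA
        rw [← hg a (mem_insert_self a D) (A.erase a), insert_erase hA.1]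
    rw [h1, ← h2]; ring

theorem sum_indicator_superset {G : Type*} [Fintype G] [DecidableEq G] (D : Finset G) :
    ∑ A : Finset G, (if D ⊆ A then (1 : ℝ) else 0) =
      2 ^ Fintype.card G * (2 ^ #D)⁻¹ := by
  have h := two_pow_mul_sum_superset D (fun _ => (1 : ℝ)) (fun _ _ _ => rfl)
  rw [eq_mul_inv_iff_mul_eq₀ (by positivity), mul_comm, h]
  simp

/-- The Harris inequality: increasing and decreasing functions are negatively correlated. -/
theorem harris_antitone {G : Type*} [Fintype G] [DecidableEq G] (f g : Finset G → ℝ)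
    (hf0 : ∀ A, 0 ≤ f A) (hg1 : ∀ A, g A ≤ 1) (hf : Monotone f) (hg : Antitone g) :
    2 ^ Fintype.card G * ∑ A, f A * g A ≤ (∑ A, f A) * ∑ A, g A := by
  have h := fkg (μ := fun _ : Finset G => (1 : ℝ)) (f := f) (g := fun A => 1 - g A)
    (fun _ => zero_le_one) hf0 (fun A => sub_nonneg.2 (hg1 A)) hf
    (fun A B hAB => sub_le_sub_left (hg hAB) 1) (fun _ _ => le_rfl)
  simp only [one_mul, mul_sub, mul_one, sum_sub_distrib, sum_const, card_univ,
    Fintype.card_finset, nsmul_eq_mul, Nat.cast_pow, Nat.cast_ofNat] at h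
  linarith

section Janson

variable {G ι : Type*} [DecidableEq G]

/-- The number of members of the family `D` contained in `A`. -/
noncomputable def containedCount (F : Finset ι) (D : ι → Finset G) (A : Finset G) : ℝ :=
  ∑ i ∈ F, if D i ⊆ A then 1 else 0

theorem containedCount_nonneg (F : Finset ι) (D : ι → Finset G) (A : Finset G) :
    0 ≤ containedCount F D A :=
  sum_nonneg fun i _ => by split_ifs <;> norm_num

theorem containedCount_mono (F : Finset ι) (D : ι → Finset G) :
    Monotone (containedCount F D) := fun A B hAB =>
  sum_le_sum fun i _ => by
    by_cases h : D i ⊆ A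
    · simp [h, h.trans hAB]
    · simp only [h, if_false]; split_ifs <;> norm_num

theorem janson_term [Fintype G] (F : Finset ι) (D : ι → Finset G) (t : ℝ) (ht : 0 ≤ t) (E : Finset G) :
    ((2 ^ #E)⁻¹ - t * ∑ j ∈ F with ¬ Disjoint (D j) E, (2 ^ #(D j ∪ E) : ℝ)⁻¹) *
        ∑ A, Real.exp (-t * containedCount F D A) ≤
      ∑ A, (if E ⊆ A then 1 else 0) * Real.exp (-t * containedCount F D A) := by
  set c : ℝ := (2 ^ #E)⁻¹ - t * ∑ j ∈ F with ¬ Disjoint (D j) E, (2 ^ #(D j ∪ E) : ℝ)⁻¹ with hc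
  have hφ : 0 ≤ ∑ A, Real.exp (-t * containedCount F D A) :=
    sum_nonneg fun _ _ => (Real.exp_pos _).le
  rcases le_or_gt c 0 with hneg | hpos
  · refine (mul_nonpos_of_nonpos_of_nonneg hneg hφ).trans (sum_nonneg fun A _ => ?_)
    exact mul_nonneg (by split_ifs <;> norm_num) (Real.exp_pos _).le
  set Y := containedCount (F.filter fun j => ¬ Disjoint (D j) E) D with hY
  set Z := containedCount (F.filter fun j => Disjoint (D j) E) D with hZ
  have hX : ∀ A, containedCount F D A = Y A + Z A := fun A => by
    simp only [hY, hZ, containedCount]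
    rw [add_comm, sum_filter_add_sum_filter_not]
  have hY0 : ∀ A, 0 ≤ Y A := containedCount_nonneg _ _
  have hZ0 : ∀ A, 0 ≤ Z A := containedCount_nonneg _ _
  have hXZ : ∑ A, Real.exp (-t * containedCount F D A) ≤ ∑ A, Real.exp (-t * Z A) :=
    sum_le_sum fun A _ => Real.exp_le_exp.2 (by rw [hX]; nlinarith [mul_nonneg ht (hY0 A)])
  refine (mul_le_mul_of_nonneg_left hXZ hpos.le).trans ?_
  have hind : 2 ^ #E * ∑ A, (if E ⊆ A then Real.exp (-t * Z A) else 0) =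
      ∑ A, Real.exp (-t * Z A) := by
    refine two_pow_mul_sum_superset E _ fun a ha A => ?_
    have : Z (insert a A) = Z A := by
      simp only [hZ, containedCount]
      refine sum_congr rfl fun j hj => ?_
      have ha' : a ∉ D j := fun h => (disjoint_left.1 (mem_filter.1 hj).2) h ha
      simp only [subset_insert_iff_of_notMem ha']
    simp only [this]
  have hcor : 2 ^ Fintype.card G * ∑ A, ((if E ⊆ A then 1 else 0) * Y A) * Real.exp (-t * Z A) ≤
      (∑ A, (if E ⊆ A then 1 else 0) * Y A) * ∑ A, Real.exp (-t * Z A) := by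
    refine harris_antitone _ _ (fun A => mul_nonneg (by split_ifs <;> norm_num) (hY0 A))
      (fun A => Real.exp_le_one_iff.2 (by nlinarith [mul_nonneg ht (hZ0 A)])) ?_ ?_
    · intro A B hAB
      refine mul_le_mul ?_ (containedCount_mono _ _ hAB) (hY0 A) (by split_ifs <;> norm_num)
      by_cases h : E ⊆ A
      · simp [h, h.trans hAB]
      · simp only [h, if_false]; split_ifs <;> norm_num
    · intro A B hAB
      refine Real.exp_le_exp.2 ?_
      have : Z A ≤ Z B := containedCount_mono _ _ hAB
      nlinarith
  have hEY : ∑ A, (if E ⊆ A then 1 else 0) * Y A =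
      2 ^ Fintype.card G * ∑ j ∈ F with ¬ Disjoint (D j) E, (2 ^ #(D j ∪ E) : ℝ)⁻¹ := by
    simp only [hY, containedCount, mul_sum]
    rw [sum_comm]
    refine sum_congr rfl fun j _ => ?_
    rw [← sum_indicator_superset]
    refine sum_congr rfl fun A _ => ?_
    by_cases h : E ⊆ A <;> by_cases h' : D j ⊆ A <;> simp [union_subset_iff, h, h']
  rw [hEY, mul_assoc] at hcor
  have hcor' := le_of_mul_le_mul_left hcor (by positivity)
  have hstep : ∑ A, ((if E ⊆ A then Real.exp (-t * Z A) else 0) -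
      t * (((if E ⊆ A then 1 else 0) * Y A) * Real.exp (-t * Z A))) ≤
      ∑ A, (if E ⊆ A then 1 else 0) * Real.exp (-t * containedCount F D A) := by
    refine sum_le_sum fun A _ => ?_
    by_cases h : E ⊆ A
    · simp only [h, if_true, one_mul, hX]
      have h1 : 1 - t * Y A ≤ Real.exp (-t * Y A) := by
        have := Real.add_one_le_exp (-t * Y A); linarith
      rw [mul_add, Real.exp_add]
      have := mul_le_mul_of_nonneg_right h1 (Real.exp_pos (-t * Z A)).le
      linarith
    · simp [h]
  refine le_trans ?_ hstep
  rw [sum_sub_distrib, ← mul_sum, hc, sub_mul, ← hind, ← mul_assoc (_⁻¹), inv_mul_cancel₀ (by positivity),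
    one_mul, hind, mul_assoc]
  exact sub_le_sub_left (mul_le_mul_of_nonneg_left hcor' ht) _

/-- The Janson inequality for uniformly random sets. -/
theorem janson [Fintype G] (F : Finset ι) (D : ι → Finset G) :
    (#{A : Finset G | ∀ i ∈ F, ¬ D i ⊆ A} : ℝ) ≤ 2 ^ Fintype.card G *
      Real.exp (-((∑ i ∈ F, (2 ^ #(D i) : ℝ)⁻¹) ^ 2 /
        (2 * ∑ i ∈ F, ∑ j ∈ F with ¬ Disjoint (D j) (D i), (2 ^ #(D j ∪ D i) : ℝ)⁻¹))) := by
  set M := ∑ i ∈ F, (2 ^ #(D i) : ℝ)⁻¹ with hM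
  set V := ∑ i ∈ F, ∑ j ∈ F with ¬ Disjoint (D j) (D i), (2 ^ #(D j ∪ D i) : ℝ)⁻¹ with hV
  set X := containedCount F D with hX
  set φ : ℝ → ℝ := fun t => ∑ A, Real.exp (-t * X A) with hφ
  have hM0 : 0 ≤ M := sum_nonneg fun _ _ => by positivity
  have hV0 : 0 ≤ V := sum_nonneg fun _ _ => sum_nonneg fun _ _ => by positivity
  have hderiv : ∀ t, HasDerivAt φ (∑ A, -(X A * Real.exp (-t * X A))) t := fun t => by
    refine HasDerivAt.fun_sum fun A _ => ?_
    have := ((hasDerivAt_id t).neg.mul_const (X A)).exp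
    simpa [mul_comm] using this
  have hbound : ∀ t, 0 ≤ t → (M - t * V) * φ t ≤ ∑ A, X A * Real.exp (-t * X A) := fun t ht => by
    have : ∑ A, X A * Real.exp (-t * X A) =
        ∑ i ∈ F, ∑ A, (if D i ⊆ A then 1 else 0) * Real.exp (-t * X A) := by
      rw [sum_comm]
      refine sum_congr rfl fun A _ => ?_
      rw [← sum_mul]; rfl
    rw [this, hM, hV, mul_sum F _ t, ← sum_sub_distrib, sum_mul]
    exact sum_le_sum fun i _ => janson_term F D t ht (D i)
  set ψ : ℝ → ℝ := fun t => φ t * Real.exp (M * t - V * t ^ 2 / 2) with hψ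
  have hψd : ∀ t, HasDerivAt ψ ((∑ A, -(X A * Real.exp (-t * X A))) *
      Real.exp (M * t - V * t ^ 2 / 2) +
      φ t * (Real.exp (M * t - V * t ^ 2 / 2) * (M - V * t))) t := fun t => by
    refine (hderiv t).mul (HasDerivAt.exp ?_)
    have h1 : HasDerivAt (fun t : ℝ => M * t) M t := by
      simpa using (hasDerivAt_id t).const_mul M
    have h2 : HasDerivAt (fun t : ℝ => V * t ^ 2 / 2) (V * t) t := by
      have := ((hasDerivAt_pow 2 t).const_mul V).div_const 2
      exact this.congr_deriv (by norm_num; ring)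
    exact h1.sub h2
  have hanti : AntitoneOn ψ (Set.Ici 0) := by
    refine antitoneOn_of_deriv_nonpos (convex_Ici 0)
      (fun t _ => (hψd t).continuousAt.continuousWithinAt)
      (fun t _ => (hψd t).differentiableAt.differentiableWithinAt) fun t ht => ?_
    rw [interior_Ici] at ht
    rw [(hψd t).deriv, sum_neg_distrib]
    have := hbound t (le_of_lt ht)
    nlinarith [Real.exp_pos (M * t - V * t ^ 2 / 2)]
  have hT : 0 ≤ M / V := div_nonneg hM0 hV0
  have hle := hanti (Set.mem_Ici.2 le_rfl) (Set.mem_Ici.2 hT) hT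
  have h0 : ψ 0 = 2 ^ Fintype.card G := by simp [hψ, hφ]
  have hexp : M * (M / V) - V * (M / V) ^ 2 / 2 = M ^ 2 / (2 * V) := by
    rcases hV0.eq_or_lt with h | h
    · simp [← h]
    · field_simp; ring
  have hcount : (#{A : Finset G | ∀ i ∈ F, ¬ D i ⊆ A} : ℝ) ≤ φ (M / V) := by
    rw [card_filter, Nat.cast_sum]
    refine sum_le_sum fun A _ => ?_
    by_cases h : ∀ i ∈ F, ¬ D i ⊆ A
    · have : X A = 0 := sum_eq_zero fun i hi => by simp [h i hi]
      rw [this, if_pos h]; simp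
    · rw [if_neg h]; simpa using (Real.exp_pos _).le
  rw [h0, hψ] at hle
  simp only [hexp] at hle
  rw [Real.exp_neg, ← div_eq_mul_inv, le_div_iff₀ (Real.exp_pos _)]
  exact (mul_le_mul_of_nonneg_right hcount (Real.exp_pos _).le).trans hle

end Janson

/-- A finite graph has a spanning forest, given by its set `R` of non-roots and the parent
map `π`. -/
theorem SimpleGraph.exists_rooted_forest {V : Type*} [Fintype V] (H : SimpleGraph V) :
    ∃ (R : Finset V) (π : V → V) (d : V → ℕ),
      (∀ v ∈ R, H.Adj v (π v) ∧ d (π v) < d v) ∧ (∀ a b, H.Adj a b → a ∈ R ∨ b ∈ R) ∧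
      ∀ a a' b, a ∉ R → a' ∉ R → H.Adj a b → H.Adj a' b → a = a' := by
  classical
  set root : V → V := fun v => (H.connectedComponentMk v).out with hroot
  have hmk : ∀ v, H.connectedComponentMk (root v) = H.connectedComponentMk v :=
    fun v => Quot.out_eq _
  have hadj : ∀ a b, H.Adj a b → root a = root b := fun a b h => by
    simp only [hroot, SimpleGraph.ConnectedComponent.eq.2 h.reachable]
  have hpar : ∀ v, ∃ w, root v ≠ v → H.Adj v w ∧ H.dist w (root w) < H.dist v (root v) := by
    intro v
    have hr : H.Reachable v (root v) := SimpleGraph.ConnectedComponent.eq.1 (hmk v).symm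
    obtain ⟨p, hp⟩ := hr.exists_walk_length_eq_dist
    by_cases hv : root v = v
    · exact ⟨v, fun h => absurd hv h⟩
    · have hnil : ¬ p.Nil := fun h => hv h.eq.symm
      refine ⟨p.snd, fun _ => ⟨p.adj_snd hnil, ?_⟩⟩
      rw [← hadj _ _ (p.adj_snd hnil)]
      have h1 := SimpleGraph.dist_le p.tail
      have h2 := p.length_tail_add_one hnil
      omega
  choose π hπ using hpar
  refine ⟨univ.filter fun v => root v ≠ v, π, fun v => H.dist v (root v), ?_, ?_, ?_⟩
  · exact fun v hv => hπ v (mem_filter.1 hv).2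
  · intro a b h
    by_contra! hc
    simp only [mem_filter, mem_univ, true_and, not_not] at hc
    exact h.ne (hc.1.symm.trans ((hadj a b h).trans hc.2))
  · intro a a' b ha ha' h h'
    simp only [mem_filter, mem_univ, true_and, not_not] at ha ha'
    exact ha.symm.trans ((hadj a b h).trans ((hadj a' b h').symm.trans ha'))

/-- The pairs `a < b` in `Fin k`. -/
def orderedPairs (k : ℕ) : Finset (Fin k × Fin k) := univ.filter fun p => p.1 < p.2

theorem mem_orderedPairs {k : ℕ} {p : Fin k × Fin k} : p ∈ orderedPairs k ↔ p.1 < p.2 := by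
  simp [orderedPairs]

theorem card_orderedPairs_le (k : ℕ) : #(orderedPairs k) ≤ k ^ 2 :=
  (card_le_univ _).trans (by simp [sq])

theorem card_edges_le_choose {k : ℕ} (R : Finset (Fin k)) (E : Finset (Fin k × Fin k))
    (hE : E ⊆ orderedPairs k) (h1 : ∀ p ∈ E, p.1 ∈ R ∨ p.2 ∈ R)
    (h2 : ∀ a a' b, a ∉ R → a' ∉ R → ((a, b) ∈ E ∨ (b, a) ∈ E) → ((a', b) ∈ E ∨ (b, a') ∈ E) →
      a = a') : #E ≤ (#R + 1).choose 2 := by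
  rw [Nat.choose_succ_succ, Nat.choose_one_right, add_comm,
    ← card_filter_add_card_filter_not (s := E) fun p => p.1 ∈ R ∧ p.2 ∈ R]
  refine add_le_add ?_ ?_
  · rw [← card_powersetCard]
    refine card_le_card_of_injOn (fun p => {p.1, p.2}) ?_ ?_
    · intro p hp
      simp only [coe_filter, Set.mem_ofPred_eq] at hp
      have := mem_orderedPairs.1 (hE hp.1)
      simp [mem_powersetCard, insert_subset_iff, hp.2, card_pair this.ne]
    · rintro ⟨a, b⟩ hp ⟨c, d⟩ hq h
      simp only [coe_filter, Set.mem_ofPred_eq] at hp hq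
      have h1 := mem_orderedPairs.1 (hE hp.1)
      have h2 := mem_orderedPairs.1 (hE hq.1)
      simp only at h1 h2 h
      have ha : a ∈ ({c, d} : Finset (Fin k)) := h ▸ by simp
      have hb : b ∈ ({c, d} : Finset (Fin k)) := h ▸ by simp
      simp only [mem_insert, mem_singleton] at ha hb
      rcases ha with rfl | rfl <;> rcases hb with rfl | rfl
      · exact absurd h1 (lt_irrefl _)
      · rfl
      · exact absurd h1 (asymm h2)
      · exact absurd h1 (lt_irrefl _)
  · refine card_le_card_of_injOn (fun p => if p.1 ∈ R then p.1 else p.2) ?_ ?_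
    · intro p hp
      simp only [coe_filter, Set.mem_ofPred_eq] at hp
      have := h1 p hp.1
      by_cases h : p.1 ∈ R
      · simp [h]
      · simpa [h] using this
    · rintro ⟨a, b⟩ hp ⟨c, d⟩ hq h
      simp only [coe_filter, Set.mem_ofPred_eq] at hp hq h
      have l1 := mem_orderedPairs.1 (hE hp.1)
      have l2 := mem_orderedPairs.1 (hE hq.1)
      have m1 := h1 _ hp.1
      have m2 := h1 _ hq.1
      simp only at l1 l2 m1 m2
      by_cases ha : a ∈ R <;> by_cases hc : c ∈ R <;> simp only [ha, hc, if_true, if_false] at h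
      · subst h
        rw [h2 b d a (by tauto) (by tauto) (Or.inr hp.1) (Or.inr hq.1)]
      · subst h
        have := h2 b c a (by tauto) hc (Or.inr hp.1) (Or.inl hq.1)
        subst this
        exact absurd l1 (asymm l2)
      · subst h
        have := h2 a d b ha (by tauto) (Or.inl hp.1) (Or.inr hq.1)
        subst this
        exact absurd l1 (asymm l2)
      · subst h
        rw [h2 a c b ha hc (Or.inl hp.1) (Or.inl hq.1)]

section Tuples

variable {G : Type*}

/-- The `k`-tuples with entries in `S`. -/
def tuplesIn (S : Finset G) (k : ℕ) : Finset (Fin k → G) := Fintype.piFinset fun _ => S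

theorem mem_tuplesIn {S : Finset G} {k : ℕ} {x : Fin k → G} :
    x ∈ tuplesIn S k ↔ ∀ i, x i ∈ S := Fintype.mem_piFinset

theorem card_tuplesIn (S : Finset G) (k : ℕ) : #(tuplesIn S k) = #S ^ k := by
  simp [tuplesIn]

/-- If the tuples in `Y` are determined by their coordinates outside `C`, there are few of them. -/
theorem card_le_pow_of_injOn_compl {S : Finset G} {k : ℕ} (C : Finset (Fin k))
    (Y : Finset (Fin k → G)) (hY : Y ⊆ tuplesIn S k)
    (hinj : ∀ x ∈ Y, ∀ y ∈ Y, (∀ i ∉ C, x i = y i) → x = y) : #Y ≤ #S ^ (k - #C) := by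
  have hcard : #(Fintype.piFinset fun _ : ↥(Cᶜ) => S) = #S ^ (k - #C) := by
    simp [card_compl]
  rw [← hcard]
  refine card_le_card_of_injOn (fun x i => x i) ?_ ?_
  · intro x hx
    rw [mem_coe, Fintype.mem_piFinset]
    exact fun i => mem_tuplesIn.1 (hY hx) i
  · intro x hx y hy h
    exact hinj x hx y hy fun i hi => congrFun h ⟨i, mem_compl.2 hi⟩

variable [AddCommGroup G] [DecidableEq G]

/-- The sums of two entries of `x` with different indices. -/
def pairSums {k : ℕ} (x : Fin k → G) : Finset G :=
  (orderedPairs k).image fun p => x p.1 + x p.2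

/-- The tuples in `S` all of whose pair sums are distinct. -/
def genericTuples (S : Finset G) (k : ℕ) : Finset (Fin k → G) :=
  (tuplesIn S k).filter fun x => #(pairSums x) = #(orderedPairs k)

theorem card_tuples_sum_eq_le {S : Finset G} {k : ℕ} {p q : Fin k × Fin k}
    (hp : p ∈ orderedPairs k) (hq : q ∈ orderedPairs k) (hpq : p ≠ q) :
    #((tuplesIn S k).filter fun x => x p.1 + x p.2 = x q.1 + x q.2) ≤ #S ^ (k - 1) := by
  obtain ⟨a, b⟩ := p
  obtain ⟨c, d⟩ := q
  rw [mem_orderedPairs] at hp hq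
  simp only at hp hq ⊢
  have key : ∀ e f : Fin k, e ≠ f → e ≠ c → e ≠ d →
      #((tuplesIn S k).filter fun x => x e + x f = x c + x d) ≤ #S ^ (k - 1) := by
    intro e f hef hec hed
    rw [← card_singleton e]
    refine card_le_pow_of_injOn_compl _ _ (filter_subset _ _) fun x hx y hy h => ?_
    have hx := (mem_filter.1 hx).2
    have hy := (mem_filter.1 hy).2
    simp only [mem_singleton] at h
    funext i
    by_cases hi : i = e
    · subst hi
      rw [h c hec.symm, h d hed.symm, ← hy, h f hef.symm] at hx
      exact add_right_cancel hx
    · exact h i hi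
  by_cases ha : a ≠ c ∧ a ≠ d
  · exact key a b hp.ne ha.1 ha.2
  · have hb : b ≠ c ∧ b ≠ d := by
      refine ⟨?_, ?_⟩
      · rintro rfl
        exact ha ⟨hp.ne, (hp.trans hq).ne⟩
      · rintro rfl
        refine ha ⟨?_, hp.ne⟩
        rintro rfl
        exact hpq rfl
    have := key b a hp.ne' hb.1 hb.2
    simpa only [add_comm] using this

theorem card_tuples_le_two_mul_generic {S : Finset G} {k : ℕ} (hk : 1 ≤ k)
    (hs : 2 * k ^ 4 ≤ #S) : #S ^ k ≤ 2 * #(genericTuples S k) := by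
  have hbad : (tuplesIn S k).filter (fun x => ¬ #(pairSums x) = #(orderedPairs k)) ⊆
      (((orderedPairs k) ×ˢ (orderedPairs k)).filter fun z => z.1 ≠ z.2).biUnion fun z =>
        (tuplesIn S k).filter fun x => x z.1.1 + x z.1.2 = x z.2.1 + x z.2.2 := by
    intro x hx
    rw [mem_filter] at hx
    have hx2 : ¬ Set.InjOn (fun p : Fin k × Fin k => x p.1 + x p.2) (orderedPairs k) :=
      fun h => hx.2 (card_image_of_injOn h)
    simp only [Set.InjOn, not_forall] at hx2
    obtain ⟨p, hp, q, hq, h, hne⟩ := hx2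
    rw [mem_biUnion]
    exact ⟨(p, q), mem_filter.2 ⟨mem_product.2 ⟨hp, hq⟩, hne⟩, mem_filter.2 ⟨hx.1, h⟩⟩
  have h1 : #((tuplesIn S k).filter (fun x => ¬ #(pairSums x) = #(orderedPairs k))) ≤
      k ^ 4 * #S ^ (k - 1) := by
    refine (card_le_card hbad).trans ((card_biUnion_le_card_mul _ _ (#S ^ (k - 1)) fun z hz => ?_).trans ?_)
    · rw [mem_filter, mem_product] at hz
      exact card_tuples_sum_eq_le hz.1.1 hz.1.2 hz.2
    · refine Nat.mul_le_mul_right _ ((card_filter_le _ _).trans ?_)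
      rw [card_product]
      calc _ ≤ k ^ 2 * k ^ 2 := Nat.mul_le_mul (card_orderedPairs_le k) (card_orderedPairs_le k)
        _ = k ^ 4 := by ring
  have h2 : #(genericTuples S k) + _ = _ := card_filter_add_card_filter_not
    (s := tuplesIn S k) (fun x => #(pairSums x) = #(orderedPairs k))
  rw [card_tuplesIn] at h2
  have h3 : 2 * k ^ 4 * #S ^ (k - 1) ≤ #S ^ k := by
    calc _ ≤ #S * #S ^ (k - 1) := Nat.mul_le_mul_right _ hs
      _ = #S ^ k := by rw [← pow_succ', Nat.sub_add_cancel hk]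
  rw [mul_assoc] at h3
  omega

/-- The number of pairs of tuples sharing a sum at given positions. -/
theorem card_tuples_share_le {S : Finset G} {k : ℕ} {p q : Fin k × Fin k}
    (hp : p ∈ orderedPairs k) (hq : q ∈ orderedPairs k) :
    #((tuplesIn S k ×ˢ tuplesIn S k).filter fun z => z.1 p.1 + z.1 p.2 = z.2 q.1 + z.2 q.2) ≤
      S.addEnergy S * (#S ^ (k - 2) * #S ^ (k - 2)) := by
  rw [mem_orderedPairs] at hp hq
  have key : ∀ e : (G × G) × (G × G),
      #((tuplesIn S k ×ˢ tuplesIn S k).filter fun z =>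
        ((z.1 p.1, z.2 q.1), (z.1 p.2, z.2 q.2)) = e) ≤ #S ^ (k - 2) * #S ^ (k - 2) := by
    intro e
    have one : ∀ (p : Fin k × Fin k) (u v : G), p.1 < p.2 →
        #((tuplesIn S k).filter fun x => x p.1 = u ∧ x p.2 = v) ≤ #S ^ (k - 2) := by
      intro p u v hp
      rw [← card_pair hp.ne]
      refine card_le_pow_of_injOn_compl _ _ (filter_subset _ _) fun x hx y hy h => ?_
      have hx := (mem_filter.1 hx).2
      have hy := (mem_filter.1 hy).2
      funext i
      by_cases hi : i ∈ ({p.1, p.2} : Finset (Fin k))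
      · simp only [mem_insert, mem_singleton] at hi
        rcases hi with rfl | rfl
        · rw [hx.1, hy.1]
        · rw [hx.2, hy.2]
      · exact h i hi
    refine le_trans (card_le_card ?_) ((card_product _ _).le.trans
      (Nat.mul_le_mul (one p e.1.1 e.2.1 hp) (one q e.1.2 e.2.2 hq)))
    intro z hz
    simp only [mem_filter, mem_product] at hz ⊢
    obtain ⟨hz, rfl⟩ := hz
    exact ⟨⟨hz.1, rfl, rfl⟩, ⟨hz.2, rfl, rfl⟩⟩
  rw [addEnergy, mul_comm]
  refine card_le_mul_card_image_of_maps_to (f := fun z => ((z.1 p.1, z.2 q.1), (z.1 p.2, z.2 q.2)))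
    ?_ _ ?_
  · intro z hz
    simp only [mem_filter, mem_product] at hz ⊢
    exact ⟨⟨⟨mem_tuplesIn.1 hz.1.1 _, mem_tuplesIn.1 hz.1.2 _⟩,
      ⟨mem_tuplesIn.1 hz.1.1 _, mem_tuplesIn.1 hz.1.2 _⟩⟩, hz.2⟩
  · intro e _
    refine (card_le_card ?_).trans (key e)
    intro z hz
    simp only [mem_filter] at hz ⊢
    exact ⟨hz.1.1, hz.2⟩

end Tuples

section Overlap

variable {G : Type*} [AddCommGroup G]

/-- Two indices are joined when the corresponding entries of `y` sum to an element of `T`. -/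
def overlapGraph {k : ℕ} (T : Finset G) (y : Fin k → G) : SimpleGraph (Fin k) where
  Adj c d := c ≠ d ∧ y c + y d ∈ T
  symm := ⟨fun _ _ h => ⟨h.1.symm, by rw [add_comm]; exact h.2⟩⟩
  loopless := ⟨fun _ h => h.1 rfl⟩

/-- The non-roots of a rooted spanning forest of the overlap graph. -/
noncomputable def nonRoots {k : ℕ} (T : Finset G) (y : Fin k → G) : Finset (Fin k) :=
  (overlapGraph T y).exists_rooted_forest.choose

/-- The parent map of a rooted spanning forest of the overlap graph. -/
noncomputable def parent {k : ℕ} (T : Finset G) (y : Fin k → G) : Fin k → Fin k :=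
  (overlapGraph T y).exists_rooted_forest.choose_spec.choose

theorem nonRoots_spec {k : ℕ} (T : Finset G) (y : Fin k → G) : ∃ d : Fin k → ℕ,
    (∀ v ∈ nonRoots T y, (overlapGraph T y).Adj v (parent T y v) ∧ d (parent T y v) < d v) ∧
    (∀ a b, (overlapGraph T y).Adj a b → a ∈ nonRoots T y ∨ b ∈ nonRoots T y) ∧
    ∀ a a' b, a ∉ nonRoots T y → a' ∉ nonRoots T y → (overlapGraph T y).Adj a b →
      (overlapGraph T y).Adj a' b → a = a' :=
  (overlapGraph T y).exists_rooted_forest.choose_spec.choose_spec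

theorem card_nonRoots_eq_le (S T : Finset G) {k : ℕ} (R : Finset (Fin k)) :
    #((tuplesIn S k).filter fun y => nonRoots T y = R) ≤ (k * #T) ^ #R * #S ^ (k - #R) := by
  have hcard : #((Fintype.piFinset fun _ : R => (univ : Finset (Fin k)) ×ˢ T) ×ˢ
      (Fintype.piFinset fun _ : ↥(Rᶜ) => S)) = (k * #T) ^ #R * #S ^ (k - #R) := by
    simp [card_compl]
  rw [← hcard]
  refine card_le_card_of_injOn
    (fun y => (fun v => (parent T y v, y v + y (parent T y v)), fun v => y v)) ?_ ?_
  · intro y hy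
    obtain ⟨hyS, rfl⟩ := mem_filter.1 hy
    obtain ⟨d, h, -⟩ := nonRoots_spec T y
    simp only [mem_coe, mem_product, Fintype.mem_piFinset, mem_univ, true_and]
    exact ⟨fun v => (h v v.2).1.2, fun v => mem_tuplesIn.1 hyS v⟩
  · intro y hy z hz hyz
    have hyR := (mem_filter.1 hy).2
    obtain ⟨d, h, -⟩ := nonRoots_spec T y
    rw [hyR] at h
    simp only [Prod.mk.injEq] at hyz
    have main : ∀ n v, d v = n → y v = z v := by
      intro n
      induction n using Nat.strong_induction_on with
      | _ n ih =>
        intro v hv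
        by_cases hvR : v ∈ R
        · have hc := congrFun hyz.1 ⟨v, hvR⟩
          simp only [Prod.mk.injEq] at hc
          have hd := (h v hvR).2
          have hpar := ih _ (hv ▸ hd) _ rfl
          rw [← hc.1, hpar] at hc
          exact add_right_cancel hc.2
        · exact congrFun hyz.2 ⟨v, mem_compl.2 hvR⟩
    exact funext fun v => main _ v rfl

variable [DecidableEq G]

theorem card_inter_pairSums_le {k : ℕ} (T : Finset G) (y : Fin k → G) :
    #(pairSums y ∩ T) ≤ (#(nonRoots T y) + 1).choose 2 := by
  obtain ⟨d, -, h1, h2⟩ := nonRoots_spec T y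
  have hsub : pairSums y ∩ T ⊆ ((orderedPairs k).filter fun p => y p.1 + y p.2 ∈ T).image
      fun p => y p.1 + y p.2 := by
    intro z hz
    obtain ⟨hz, hzT⟩ := mem_inter.1 hz
    obtain ⟨p, hp, rfl⟩ := mem_image.1 hz
    exact mem_image_of_mem _ (mem_filter.2 ⟨hp, hzT⟩)
  refine (card_le_card hsub).trans (card_image_le.trans ?_)
  have hadj : ∀ a b, ((a, b) ∈ (orderedPairs k).filter (fun p => y p.1 + y p.2 ∈ T) ∨
      (b, a) ∈ (orderedPairs k).filter (fun p => y p.1 + y p.2 ∈ T)) →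
      (overlapGraph T y).Adj a b := by
    rintro a b (h | h) <;> rw [mem_filter, mem_orderedPairs] at h
    · exact ⟨h.1.ne, h.2⟩
    · exact ⟨h.1.ne', by rw [add_comm]; exact h.2⟩
  exact card_edges_le_choose _ _ (filter_subset _ _) (fun p hp => h1 _ _ (hadj p.1 p.2 (Or.inl hp)))
    fun a a' b ha ha' h h' => h2 a a' b ha ha' (hadj _ _ h) (hadj _ _ h')

theorem card_card_nonRoots_eq_le (S T : Finset G) {k : ℕ} (hT : #T ≤ k ^ 2) (r : ℕ) :
    #((tuplesIn S k).filter fun y => #(nonRoots T y) = r) ≤ k ^ (4 * r) * #S ^ (k - r) := by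
  have hsub : (tuplesIn S k).filter (fun y => #(nonRoots T y) = r) ⊆
      (powersetCard r univ).biUnion fun R => (tuplesIn S k).filter fun y => nonRoots T y = R := by
    intro y hy
    obtain ⟨hy, hr⟩ := mem_filter.1 hy
    exact mem_biUnion.2 ⟨_, mem_powersetCard.2 ⟨subset_univ _, hr⟩, mem_filter.2 ⟨hy, rfl⟩⟩
  refine (card_le_card hsub).trans ((card_biUnion_le_card_mul _ _
    ((k * #T) ^ r * #S ^ (k - r)) fun R hR => ?_).trans ?_)
  · have := card_nonRoots_eq_le S T R
    rwa [(mem_powersetCard.1 hR).2] at this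
  · rw [card_powersetCard, card_univ, Fintype.card_fin, ← mul_assoc]
    refine Nat.mul_le_mul_right _ ?_
    calc k.choose r * (k * #T) ^ r ≤ k ^ r * (k * k ^ 2) ^ r := by
          gcongr; exact Nat.choose_le_pow k r
      _ = k ^ (4 * r) := by rw [← mul_pow, pow_mul]; ring

theorem card_pairSums_le {k : ℕ} (x : Fin k → G) : #(pairSums x) ≤ k ^ 2 :=
  card_image_le.trans (card_orderedPairs_le k)

theorem sum_overlap_le (S : Finset G) (k : ℕ) (M : ℝ) (hM : 0 < M)
    (hr : ∀ r ∈ Icc 2 k, (2 : ℝ) ^ (r + 1).choose 2 * k ^ (4 * r) * (k * M) ≤ (#S : ℝ) ^ r) :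
    ∑ x ∈ genericTuples S k, ∑ y ∈ genericTuples S k with ¬ Disjoint (pairSums y) (pairSums x),
      (2 : ℝ) ^ #(pairSums y ∩ pairSums x) ≤
      2 * k ^ 4 * S.addEnergy S * ((#S : ℝ) ^ (k - 2)) ^ 2 + (#S : ℝ) ^ k * (#S : ℝ) ^ k / M := by
  have hpt : ∀ x y : Fin k → G, (if ¬ Disjoint (pairSums y) (pairSums x) then
      (2 : ℝ) ^ #(pairSums y ∩ pairSums x) else 0) ≤
      2 * (if ¬ Disjoint (pairSums y) (pairSums x) then 1 else 0) +
      ∑ r ∈ Icc 2 k, (if #(nonRoots (pairSums x) y) = r then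
        (2 : ℝ) ^ (r + 1).choose 2 else 0) := by
    intro x y
    have h0 : 0 ≤ ∑ r ∈ Icc 2 k, (if #(nonRoots (pairSums x) y) = r then
        (2 : ℝ) ^ (r + 1).choose 2 else 0) := sum_nonneg fun r _ => by positivity
    by_cases hd : Disjoint (pairSums y) (pairSums x)
    · simpa [hd] using h0
    simp only [hd, not_false_eq_true, if_true, mul_one]
    have hle := card_inter_pairSums_le (pairSums x) y
    rcases lt_or_ge (#(nonRoots (pairSums x) y)) 2 with h | h
    · have hj : #(pairSums y ∩ pairSums x) ≤ 1 := by
        refine hle.trans ?_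
        interval_cases #(nonRoots (pairSums x) y) <;> decide
      have : (2 : ℝ) ^ #(pairSums y ∩ pairSums x) ≤ 2 ^ 1 :=
        pow_le_pow_right₀ one_le_two hj
      linarith
    · have hk : #(nonRoots (pairSums x) y) ≤ k := (card_le_univ _).trans (by simp)
      rw [sum_ite_eq, if_pos (mem_Icc.2 ⟨h, hk⟩)]
      have : (2 : ℝ) ^ #(pairSums y ∩ pairSums x) ≤ 2 ^ (#(nonRoots (pairSums x) y) + 1).choose 2 :=
        pow_le_pow_right₀ one_le_two hle
      linarith
  have hgen : genericTuples S k ⊆ tuplesIn S k := filter_subset _ _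
  have hshare : ∑ x ∈ tuplesIn S k, ∑ y ∈ tuplesIn S k,
      (if ¬ Disjoint (pairSums y) (pairSums x) then (1 : ℝ) else 0) ≤
      k ^ 4 * (S.addEnergy S * ((#S : ℝ) ^ (k - 2)) ^ 2) := by
    rw [← sum_product', ← sum_filter, sum_const, nsmul_one]
    have hsub : (tuplesIn S k ×ˢ tuplesIn S k).filter
        (fun z => ¬ Disjoint (pairSums z.2) (pairSums z.1)) ⊆
        (orderedPairs k ×ˢ orderedPairs k).biUnion fun w =>
          (tuplesIn S k ×ˢ tuplesIn S k).filter fun z =>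
            z.1 w.1.1 + z.1 w.1.2 = z.2 w.2.1 + z.2 w.2.2 := by
      intro z hz
      obtain ⟨hz, hd⟩ := mem_filter.1 hz
      obtain ⟨u, hu, hu'⟩ := not_disjoint_iff.1 hd
      obtain ⟨q, hq, rfl⟩ := mem_image.1 hu
      obtain ⟨p, hp, h⟩ := mem_image.1 hu'
      exact mem_biUnion.2 ⟨(p, q), mem_product.2 ⟨hp, hq⟩, mem_filter.2 ⟨hz, h⟩⟩
    have hc := (card_le_card hsub).trans (card_biUnion_le_card_mul _ _
      (S.addEnergy S * (#S ^ (k - 2) * #S ^ (k - 2))) fun w hw =>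
        card_tuples_share_le (mem_product.1 hw).1 (mem_product.1 hw).2)
    have hc2 : #(orderedPairs k ×ˢ orderedPairs k) ≤ k ^ 4 := by
      rw [card_product]
      calc _ ≤ k ^ 2 * k ^ 2 := Nat.mul_le_mul (card_orderedPairs_le k) (card_orderedPairs_le k)
        _ = k ^ 4 := by ring
    have := hc.trans (Nat.mul_le_mul_right _ hc2)
    rw [sq]
    exact_mod_cast this
  have hrank : ∀ x ∈ tuplesIn S k, ∑ y ∈ tuplesIn S k, ∑ r ∈ Icc 2 k,
      (if #(nonRoots (pairSums x) y) = r then (2 : ℝ) ^ (r + 1).choose 2 else 0) ≤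
      (#S : ℝ) ^ k / M := by
    intro x _
    rw [sum_comm]
    have hterm : ∀ r ∈ Icc 2 k, ∑ y ∈ tuplesIn S k,
        (if #(nonRoots (pairSums x) y) = r then (2 : ℝ) ^ (r + 1).choose 2 else 0) ≤
        (#S : ℝ) ^ k / (k * M) := by
      intro r hrk
      have h2 := (mem_Icc.1 hrk)
      have hk0 : (0 : ℝ) < k := by
        have : 0 < k := by omega
        exact_mod_cast this
      rw [← sum_filter, sum_const, nsmul_eq_mul]
      have hc : ((#((tuplesIn S k).filter fun y => #(nonRoots (pairSums x) y) = r) : ℕ) : ℝ) ≤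
          k ^ (4 * r) * (#S : ℝ) ^ (k - r) := by
        exact_mod_cast card_card_nonRoots_eq_le S (pairSums x) (card_pairSums_le x) r
      rw [le_div_iff₀ (by positivity)]
      calc _ ≤ k ^ (4 * r) * (#S : ℝ) ^ (k - r) * 2 ^ (r + 1).choose 2 * (k * M) := by
            gcongr
        _ = (2 ^ (r + 1).choose 2 * k ^ (4 * r) * (k * M)) * (#S : ℝ) ^ (k - r) := by ring
        _ ≤ (#S : ℝ) ^ r * (#S : ℝ) ^ (k - r) := by gcongr; exact hr r hrk
        _ = (#S : ℝ) ^ k := by rw [← pow_add]; congr 1; omega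
    refine (sum_le_sum hterm).trans ?_
    rw [sum_const, nsmul_eq_mul, Nat.card_Icc]
    rcases Nat.eq_zero_or_pos k with rfl | hk
    · simp [hM.le]
    · have hk0 : (0 : ℝ) < k := by exact_mod_cast hk
      have : ((k + 1 - 2 : ℕ) : ℝ) ≤ k := by exact_mod_cast (by omega : k + 1 - 2 ≤ k)
      calc _ ≤ (k : ℝ) * ((#S : ℝ) ^ k / (k * M)) := by gcongr
        _ = _ := by field_simp
  calc _ ≤ ∑ x ∈ genericTuples S k, ∑ y ∈ genericTuples S k,
        (2 * (if ¬ Disjoint (pairSums y) (pairSums x) then 1 else 0) +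
          ∑ r ∈ Icc 2 k, (if #(nonRoots (pairSums x) y) = r then
            (2 : ℝ) ^ (r + 1).choose 2 else 0)) := by
        refine sum_le_sum fun x _ => ?_
        rw [sum_filter]
        exact sum_le_sum fun y _ => hpt x y
    _ ≤ ∑ x ∈ tuplesIn S k, ∑ y ∈ tuplesIn S k,
        (2 * (if ¬ Disjoint (pairSums y) (pairSums x) then 1 else 0) +
          ∑ r ∈ Icc 2 k, (if #(nonRoots (pairSums x) y) = r then
            (2 : ℝ) ^ (r + 1).choose 2 else 0)) := by
        have hnn : ∀ x y : Fin k → G,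
            0 ≤ (2 * (if ¬ Disjoint (pairSums y) (pairSums x) then 1 else 0) +
          ∑ r ∈ Icc 2 k, (if #(nonRoots (pairSums x) y) = r then
            (2 : ℝ) ^ (r + 1).choose 2 else 0)) := fun x y =>
          le_trans (by positivity) (hpt x y)
        refine (sum_le_sum fun x _ => sum_le_sum_of_subset_of_nonneg hgen
          fun y _ _ => hnn x y).trans ?_
        exact sum_le_sum_of_subset_of_nonneg hgen fun x _ _ => sum_nonneg fun y _ => hnn x y
    _ ≤ _ := by
        simp only [sum_add_distrib, ← mul_sum]
        refine add_le_add ?_ ?_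
        · linarith
        · refine (sum_le_sum hrank).trans ?_
          rw [sum_const, nsmul_eq_mul, card_tuplesIn, Nat.cast_pow, mul_div_assoc]

theorem sum_inv_two_pow_union_eq {G ι : Type*} [DecidableEq G] (F : Finset ι) (D : ι → Finset G) (K : ℕ)
    (hK : ∀ x ∈ F, #(D x) = K) :
    ∑ i ∈ F, ∑ j ∈ F with ¬ Disjoint (D j) (D i), (2 ^ #(D j ∪ D i) : ℝ)⁻¹ =
      (2 ^ K)⁻¹ ^ 2 * ∑ i ∈ F, ∑ j ∈ F with ¬ Disjoint (D j) (D i), (2 : ℝ) ^ #(D j ∩ D i) := by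
  rw [mul_sum]
  refine sum_congr rfl fun x hx => ?_
  rw [mul_sum]
  refine sum_congr rfl fun y hy => ?_
  have h := card_union_add_card_inter (D y) (D x)
  rw [hK x hx, hK y (mem_filter.1 hy).1] at h
  have h' : (2 : ℝ) ^ #(D y ∪ D x) * 2 ^ #(D y ∩ D x) = 2 ^ K * 2 ^ K := by
    rw [← pow_add, h, pow_add]
  field_simp
  rw [sq, ← h', mul_comm]

theorem sum_overlap_pos (S : Finset G) (k : ℕ) (hk : 2 ≤ k) (hF : (genericTuples S k).Nonempty) :
    0 < ∑ x ∈ genericTuples S k,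
      ∑ y ∈ genericTuples S k with ¬ Disjoint (pairSums y) (pairSums x),
        (2 : ℝ) ^ #(pairSums y ∩ pairSums x) := by
  obtain ⟨x, hx⟩ := hF
  refine sum_pos' (fun x _ => sum_nonneg fun y _ => by positivity) ⟨x, hx, ?_⟩
  refine sum_pos (fun y _ => by positivity) ⟨x, mem_filter.2 ⟨hx, ?_⟩⟩
  rw [disjoint_self, bot_eq_empty]
  refine Nonempty.ne_empty (Nonempty.image ⟨(⟨0, by omega⟩, ⟨1, by omega⟩), ?_⟩ _)
  rw [mem_orderedPairs]
  exact Fin.mk_lt_mk.2 one_pos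

theorem overlap_bound_aux {s k T N E V : ℝ} {n : ℕ} (hn : 2 ≤ n) (hs : 0 ≤ s) (hk : 1 ≤ k)
    (hN : 0 < N) (hT : 0 ≤ T) (hE : E ≤ T) (hsT : s ^ 4 ≤ N * T)
    (hV : V ≤ 2 * k ^ 4 * E * (s ^ (n - 2)) ^ 2 + s ^ n * s ^ n / N) :
    V * s ^ 4 ≤ 3 * k ^ 4 * T * (s ^ n * s ^ n) := by
  have hspow : (s ^ (n - 2)) ^ 2 * s ^ 4 = s ^ n * s ^ n := by
    rw [← pow_mul, ← pow_add, ← pow_add]; congr 1; omega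
  have h1 : s ^ n * s ^ n / N * s ^ 4 ≤ k ^ 4 * T * (s ^ n * s ^ n) := by
    rw [div_mul_eq_mul_div, div_le_iff₀ hN]
    have : s ^ 4 ≤ k ^ 4 * (N * T) :=
      hsT.trans (le_mul_of_one_le_left (by positivity) (one_le_pow₀ hk))
    calc _ ≤ s ^ n * s ^ n * (k ^ 4 * (N * T)) := by gcongr
      _ = _ := by ring
  have h2 : 2 * k ^ 4 * E * (s ^ (n - 2)) ^ 2 * s ^ 4 ≤ 2 * k ^ 4 * T * (s ^ n * s ^ n) := by
    rw [mul_assoc _ (_ ^ 2) (_ ^ 4), hspow]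
    gcongr
  refine (mul_le_mul_of_nonneg_right hV (by positivity)).trans ?_
  rw [add_mul]
  exact (add_le_add h2 h1).trans (le_of_eq (by ring))

theorem janson_exponent_aux {s k T V F q P : ℝ} (hk : 0 < k) (hT : 0 < T) (hV : 0 < V) (hq : 0 < q)
    (hP : 0 ≤ P) (hPF : P ≤ 2 * F) (h : V * s ^ 4 ≤ 3 * k ^ 4 * T * (P * P)) :
    s ^ 4 / (24 * k ^ 4 * T) ≤ (F * q) ^ 2 / (2 * (q ^ 2 * V)) := by
  rw [div_le_div_iff₀ (by positivity) (by positivity)]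
  have hFF : P * P ≤ 4 * F ^ 2 := by nlinarith
  calc s ^ 4 * (2 * (q ^ 2 * V)) = 2 * q ^ 2 * (V * s ^ 4) := by ring
    _ ≤ 2 * q ^ 2 * (3 * k ^ 4 * T * (4 * F ^ 2)) := by
        refine mul_le_mul_of_nonneg_left (h.trans ?_) (by positivity)
        gcongr
    _ = _ := by ring

/-- If `S` has small additive energy, then only few sets `A` contain no set of pair sums of a
generic `k`-tuple from `S`. -/
theorem card_no_generic_le [Fintype G] (S : Finset G) (k : ℕ) (hk : 2 ≤ k) (T : ℝ)
    (hs : 2 * k ^ 4 ≤ #S) (hT : (S.addEnergy S : ℝ) ≤ T)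
    (hsT : (#S : ℝ) ^ 4 ≤ Fintype.card G * T)
    (hr : ∀ r ∈ Icc 2 k, (2 : ℝ) ^ (r + 1).choose 2 * k ^ (4 * r) * (k * Fintype.card G) ≤
      (#S : ℝ) ^ r) :
    (#{A : Finset G | ∀ x ∈ genericTuples S k, ¬ pairSums x ⊆ A} : ℝ) ≤
      2 ^ Fintype.card G * Real.exp (-((#S : ℝ) ^ 4 / (24 * k ^ 4 * T))) := by
  refine le_trans (le_of_eq (by congr!)) ((janson (genericTuples S k) pairSums).trans ?_)
  refine mul_le_mul_of_nonneg_left (Real.exp_le_exp.2 (neg_le_neg ?_)) (by positivity)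
  have hKF : ∀ x ∈ genericTuples S k, #(pairSums x) = #(orderedPairs k) :=
    fun x hx => (mem_filter.1 hx).2
  have hN : (0 : ℝ) < Fintype.card G := by
    have : 0 < Fintype.card G := Fintype.card_pos
    exact_mod_cast this
  have hk1 : (1 : ℝ) ≤ k := by exact_mod_cast (by omega : 1 ≤ k)
  have hs0 : (0 : ℝ) < #S := by
    have : 0 < 2 * k ^ 4 := by positivity
    exact_mod_cast this.trans_le hs
  have hT0 : 0 < T := by
    by_contra! h
    have h1 := mul_nonpos_of_nonneg_of_nonpos hN.le h
    have h2 : (0 : ℝ) < (#S : ℝ) ^ 4 := by positivity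
    linarith
  have hFs : (#S : ℝ) ^ k ≤ 2 * #(genericTuples S k) := by
    exact_mod_cast card_tuples_le_two_mul_generic (by omega) hs
  have hF : (genericTuples S k).Nonempty := by
    rw [← card_pos]
    have : (0 : ℝ) < (#S : ℝ) ^ k := by positivity
    have : (0 : ℝ) < #(genericTuples S k) := by linarith
    exact_mod_cast this
  rw [sum_inv_two_pow_union_eq _ _ _ hKF, sum_congr rfl fun x hx => by rw [hKF x hx], sum_const,
    nsmul_eq_mul]
  exact janson_exponent_aux (by linarith) hT0 (sum_overlap_pos S k hk hF) (by positivity)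
    (by positivity) hFs
    (overlap_bound_aux hk hs0.le hk1 hN hT0.le hT hsT (sum_overlap_le S k _ hN hr))

end Overlap

section Energy

variable {G : Type*} [AddCommGroup G] [Fintype G] [DecidableEq G]

/-- The additive quadruples of `G`. -/
def additiveQuads (G : Type*) [AddCommGroup G] [Fintype G] [DecidableEq G] :
    Finset ((G × G) × (G × G)) :=
  univ.filter fun z => z.1.1 + z.2.1 = z.1.2 + z.2.2

/-- The entries of the quadruple are pairwise distinct. -/
def QuadDistinct {G : Type*} (z : (G × G) × (G × G)) : Prop :=
  z.1.1 ≠ z.1.2 ∧ z.1.1 ≠ z.2.1 ∧ z.1.1 ≠ z.2.2 ∧ z.1.2 ≠ z.2.1 ∧ z.1.2 ≠ z.2.2 ∧ z.2.1 ≠ z.2.2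

theorem mem_additiveQuads {a b c d : G} : ((a, b), (c, d)) ∈ additiveQuads G ↔ a + c = b + d := by
  simp [additiveQuads]

theorem card_additiveQuads_le : #(additiveQuads G) ≤ Fintype.card G ^ 3 := by
  have : Fintype.card G ^ 3 = #(univ : Finset (G × G × G)) := by
    simp [Fintype.card_prod]; ring
  rw [this]
  refine card_le_card_of_injOn (fun z => (z.1.1, z.1.2, z.2.1)) (fun _ _ => mem_coe.2 (mem_univ _)) ?_
  rintro ⟨⟨a, b⟩, c, d⟩ h ⟨⟨a', b'⟩, c', d'⟩ h' he
  rw [mem_coe, mem_additiveQuads] at h h'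
  simp only [Prod.mk.injEq] at he
  obtain ⟨rfl, rfl, rfl⟩ := he
  rw [h] at h'
  rw [add_left_cancel h']

open Classical in
theorem card_not_quadDistinct_le :
    #((additiveQuads G).filter fun z => ¬ QuadDistinct z) ≤ 4 * Fintype.card G ^ 2 := by
  have hsub : (additiveQuads G).filter (fun z => ¬ QuadDistinct z) ⊆
      (univ.image fun p : G × G => ((p.1, p.1), (p.2, p.2))) ∪
      (univ.image fun p : G × G => ((p.1, p.2), (p.2, p.1))) ∪
      (univ.image fun p : G × G => ((p.1, p.2), (p.1, p.1 + p.1 - p.2))) ∪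
      (univ.image fun p : G × G => ((p.1, p.2), (p.2 + p.2 - p.1, p.2))) := by
    rintro ⟨⟨a, b⟩, c, d⟩ hz
    obtain ⟨h, hn⟩ := mem_filter.1 hz
    rw [mem_additiveQuads] at h
    simp only [mem_union, mem_image, mem_univ, true_and, Prod.exists, Prod.mk.injEq]
    by_contra! hc
    obtain ⟨⟨⟨h1, h2⟩, h3⟩, h4⟩ := hc
    have hab : a ≠ b := fun e => h1 a c ⟨rfl, e⟩ rfl (add_left_cancel (e ▸ h))
    have had : a ≠ d := fun e => h2 a b ⟨rfl, rfl⟩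
      (add_right_cancel (h.symm.trans (by rw [e, add_comm]))) e
    have hac : a ≠ c := fun e => h3 a b ⟨rfl, rfl⟩ e (by rw [sub_eq_iff_eq_add, add_comm d, ← h, ← e])
    have hbd : b ≠ d := fun e => h4 a b ⟨rfl, rfl⟩
      (by rw [sub_eq_iff_eq_add, add_comm c, h, ← e]) e
    have hbc : b ≠ c := fun e => had (add_right_cancel (h.trans (by rw [e, add_comm])))
    have hcd : c ≠ d := fun e => hab (add_right_cancel (h.trans (by rw [e])))
    exact hn ⟨hab, hac, had, hbc, hbd, hcd⟩
  have himg : ∀ g : G × G → (G × G) × (G × G), #(univ.image g) ≤ Fintype.card G ^ 2 := fun g =>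
    card_image_le.trans (by simp [sq])
  refine (card_le_card hsub).trans ((card_union_le _ _).trans ?_)
  refine (add_le_add ((card_union_le _ _).trans
    (add_le_add ((card_union_le _ _).trans (add_le_add (himg _) (himg _))) (himg _)))
    (himg _)).trans (le_of_eq (by ring))

theorem card_const_on_quad_le {G : Type*} [Fintype G] [DecidableEq G] {m : ℕ} (z : (G × G) × (G × G)) (hz : QuadDistinct z) :
    m ^ 3 * #{f : G → Fin m | f z.1.2 = f z.1.1 ∧ f z.2.1 = f z.1.1 ∧ f z.2.2 = f z.1.1} ≤
      m ^ Fintype.card G := by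
  obtain ⟨⟨a, b⟩, c, d⟩ := z
  obtain ⟨hab, hac, had, hbc, hbd, hcd⟩ := hz
  simp only at hab hac had hbc hbd hcd ⊢
  set C : Finset G := {b, c, d} with hC
  have hC3 : #C = 3 := by
    rw [hC, card_insert_of_notMem (by simp [hbc, hbd]), card_pair hcd]
  have ha : a ∉ C := by simp [hC, hab, hac, had]
  have h3 : 3 ≤ Fintype.card G := hC3 ▸ card_le_univ C
  have hcard : #(univ : Finset (↥(Cᶜ) → Fin m)) = m ^ (Fintype.card G - 3) := by
    rw [card_univ, Fintype.card_fun, Fintype.card_fin, Fintype.card_coe, card_compl, hC3]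
  have hle : #{f : G → Fin m | f b = f a ∧ f c = f a ∧ f d = f a} ≤ m ^ (Fintype.card G - 3) := by
    rw [← hcard]
    refine card_le_card_of_injOn (fun f i => f i) (fun _ _ => mem_coe.2 (mem_univ _)) ?_
    intro f hf g hg h
    simp only [coe_filter, mem_univ, true_and, Set.mem_ofPred_eq] at hf hg
    have hout : ∀ i ∉ C, f i = g i := fun i hi => congrFun h ⟨i, mem_compl.2 hi⟩
    funext i
    by_cases hi : i ∈ C
    · simp only [hC, mem_insert, mem_singleton] at hi
      rcases hi with rfl | rfl | rfl
      · rw [hf.1, hg.1, hout a ha]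
      · rw [hf.2.1, hg.2.1, hout a ha]
      · rw [hf.2.2, hg.2.2, hout a ha]
    · exact hout i hi
  calc _ ≤ m ^ 3 * m ^ (Fintype.card G - 3) := Nat.mul_le_mul_left _ hle
    _ = _ := by rw [← pow_add, Nat.add_sub_cancel' h3]

/-- The fibre of `f` over `c`. -/
def fibre {G : Type*} [Fintype G] {m : ℕ} (f : G → Fin m) (c : Fin m) : Finset G := univ.filter fun x => f x = c

theorem sum_addEnergy_fibre_le {m : ℕ} (f : G → Fin m) :
    ∑ c, (fibre f c).addEnergy (fibre f c) ≤ #((additiveQuads G).filter fun z =>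
      f z.1.2 = f z.1.1 ∧ f z.2.1 = f z.1.1 ∧ f z.2.2 = f z.1.1) := by
  have h : ∀ c, (fibre f c).addEnergy (fibre f c) ≤ #(((additiveQuads G).filter fun z =>
      f z.1.2 = f z.1.1 ∧ f z.2.1 = f z.1.1 ∧ f z.2.2 = f z.1.1).filter fun z => f z.1.1 = c) := by
    intro c
    refine card_le_card ?_
    rintro ⟨⟨x, y⟩, u, v⟩ hz
    simp only [fibre, mem_filter, mem_product, mem_univ, true_and] at hz
    simp only [mem_filter, mem_additiveQuads]
    obtain ⟨⟨⟨h1, h2⟩, h3, h4⟩, h5⟩ := hz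
    exact ⟨⟨h5, by rw [h1, h2], by rw [h1, h3], by rw [h1, h4]⟩, h1⟩
  refine (sum_le_sum fun c _ => h c).trans (le_of_eq ?_)
  exact (card_eq_sum_card_fiberwise fun _ _ => mem_coe.2 (mem_univ _)).symm

/-- A random colouring with `m` colours has colour classes of small total energy. -/
theorem exists_fibres_small_energy (m : ℕ) (hm : 1 ≤ m) (hmN : m ^ 3 ≤ Fintype.card G) :
    ∃ f : G → Fin m, m ^ 3 * ∑ c, (fibre f c).addEnergy (fibre f c) ≤ 5 * Fintype.card G ^ 3 := by
  classical
  by_contra! hcon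
  set N := Fintype.card G with hN
  have hlow : #(univ : Finset (G → Fin m)) * (5 * N ^ 3) <
      ∑ f : G → Fin m, m ^ 3 * #((additiveQuads G).filter fun z =>
        f z.1.2 = f z.1.1 ∧ f z.2.1 = f z.1.1 ∧ f z.2.2 = f z.1.1) := by
    rw [← smul_eq_mul, ← sum_const]
    refine sum_lt_sum_of_nonempty ⟨fun _ => ⟨0, hm⟩, mem_univ _⟩ fun f _ => ?_
    exact (hcon f).trans_le (Nat.mul_le_mul_left _ (sum_addEnergy_fibre_le f))
  have hswap : ∑ f : G → Fin m, m ^ 3 * #((additiveQuads G).filter fun z =>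
        f z.1.2 = f z.1.1 ∧ f z.2.1 = f z.1.1 ∧ f z.2.2 = f z.1.1) =
      ∑ z ∈ additiveQuads G, m ^ 3 *
        #{f : G → Fin m | f z.1.2 = f z.1.1 ∧ f z.2.1 = f z.1.1 ∧ f z.2.2 = f z.1.1} := by
    simp only [card_filter, ← mul_sum]
    rw [sum_comm]
  have hup : ∑ z ∈ additiveQuads G, m ^ 3 *
        #{f : G → Fin m | f z.1.2 = f z.1.1 ∧ f z.2.1 = f z.1.1 ∧ f z.2.2 = f z.1.1} ≤
      m ^ N * (5 * N ^ 3) := by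
    rw [← sum_filter_add_sum_filter_not _ (fun z => QuadDistinct z)]
    have h1 : ∑ z ∈ (additiveQuads G).filter (fun z => QuadDistinct z), m ^ 3 *
        #{f : G → Fin m | f z.1.2 = f z.1.1 ∧ f z.2.1 = f z.1.1 ∧ f z.2.2 = f z.1.1} ≤
        N ^ 3 * m ^ N := by
      refine (sum_le_card_nsmul _ _ (m ^ N) fun z hz =>
        card_const_on_quad_le z (mem_filter.1 hz).2).trans ?_
      rw [smul_eq_mul]
      exact Nat.mul_le_mul_right _ ((card_filter_le _ _).trans card_additiveQuads_le)
    have h2 : ∑ z ∈ (additiveQuads G).filter (fun z => ¬ QuadDistinct z), m ^ 3 *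
        #{f : G → Fin m | f z.1.2 = f z.1.1 ∧ f z.2.1 = f z.1.1 ∧ f z.2.2 = f z.1.1} ≤
        4 * N ^ 2 * (N * m ^ N) := by
      refine (sum_le_card_nsmul _ _ (N * m ^ N) fun z hz =>
        Nat.mul_le_mul hmN ((card_le_univ _).trans (by simp [hN]))).trans ?_
      rw [smul_eq_mul]
      exact Nat.mul_le_mul_right _ card_not_quadDistinct_le
    calc _ ≤ N ^ 3 * m ^ N + 4 * N ^ 2 * (N * m ^ N) := add_le_add h1 h2
      _ = _ := by ring
  rw [hswap] at hlow
  have hc : #(univ : Finset (G → Fin m)) = m ^ N := by simp [hN]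
  rw [hc] at hlow
  exact absurd hup (not_le.2 hlow)

end Energy

section Colouring

variable {G : Type*} [AddCommGroup G]

/-- `P` can be partitioned into `n` (possibly empty) sets whose restricted sumsets lie in `A`. -/
def SumColorable (A P : Finset G) (n : ℕ) : Prop :=
  ∃ c : G → ℕ, (∀ x ∈ P, c x < n) ∧ ∀ x ∈ P, ∀ y ∈ P, x ≠ y → c x = c y → x + y ∈ A

theorem SumColorable.mono {A P : Finset G} {n n' : ℕ} (h : SumColorable A P n) (hn : n ≤ n') :
    SumColorable A P n' := by
  obtain ⟨c, h1, h2⟩ := h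
  exact ⟨c, fun x hx => (h1 x hx).trans_le hn, h2⟩

theorem sumColorable_card (A P : Finset G) : SumColorable A P #P := by
  classical
  refine ⟨fun x => if h : x ∈ P then P.equivFin ⟨x, h⟩ else 0, fun x hx => ?_, ?_⟩
  · simp [hx]
  · intro x hx y hy hne h
    simp only [hx, hy, dif_pos] at h
    have := P.equivFin.injective (Fin.ext h)
    exact absurd (congrArg Subtype.val this) hne

theorem sumColorable_one {A P : Finset G} (h : ∀ x ∈ P, ∀ y ∈ P, x ≠ y → x + y ∈ A) :
    SumColorable A P 1 :=
  ⟨fun _ => 0, fun _ _ => one_pos, fun x hx y hy hne _ => h x hx y hy hne⟩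

variable [DecidableEq G]

theorem SumColorable.union {A P Q : Finset G} {n n' : ℕ} (h : SumColorable A P n)
    (h' : SumColorable A Q n') : SumColorable A (P ∪ Q) (n + n') := by
  obtain ⟨c, h1, h2⟩ := h
  obtain ⟨c', h1', h2'⟩ := h'
  refine ⟨fun x => if x ∈ P then c x else n + c' x, fun x hx => ?_, fun x hx y hy hne hc => ?_⟩
  · by_cases hP : x ∈ P
    · have := h1 x hP
      simp only [hP, if_true]; omega
    · have := h1' x ((mem_union.1 hx).resolve_left hP)
      simp only [hP, if_false]; omega
  · by_cases hP : x ∈ P <;> by_cases hP' : y ∈ P <;> simp only [hP, hP', if_true, if_false] at hc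
    · exact h2 x hP y hP' hne hc
    · have := h1 x hP
      omega
    · have := h1 y hP'
      omega
    · exact h2' x ((mem_union.1 hx).resolve_left hP) y ((mem_union.1 hy).resolve_left hP') hne
        (by omega)

theorem sumColorable_biUnion {ι : Type*} [DecidableEq ι] {A : Finset G} (I : Finset ι)
    (P : ι → Finset G) (n : ι → ℕ) (h : ∀ i ∈ I, SumColorable A (P i) (n i)) :
    SumColorable A (I.biUnion P) (∑ i ∈ I, n i) := by
  induction I using Finset.induction_on with
  | empty => exact ⟨fun _ => 0, by simp, by simp⟩
  | insert i I hi ih =>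
    rw [biUnion_insert, sum_insert hi]
    exact (h i (mem_insert_self _ _)).union (ih fun j hj => h j (mem_insert_of_mem hj))

/-- Greedy colouring of a set all of whose `s`-subsets contain a good `k`-set. -/
theorem sumColorable_greedy {A : Finset G} {k s : ℕ} (hk : 1 ≤ k) (P : Finset G)
    (h : ∀ S ⊆ P, #S = s → ∃ X ⊆ S, #X = k ∧ ∀ x ∈ X, ∀ y ∈ X, x ≠ y → x + y ∈ A) :
    ∃ q, q * k ≤ #P ∧ SumColorable A P (q + s) := by
  induction P using Finset.strongInduction with
  | H P ih =>
    rcases le_or_gt (#P) s with hP | hP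
    · exact ⟨0, by simp, (sumColorable_card A P).mono (by omega)⟩
    · obtain ⟨S, hSP, hS⟩ := exists_subset_card_eq hP.le
      obtain ⟨X, hXS, hX, hXA⟩ := h S hSP hS
      have hXP := hXS.trans hSP
      have hXne : X.Nonempty := card_pos.1 (by omega)
      obtain ⟨q, hq, hc⟩ := ih (P \ X) (sdiff_ssubset hXP hXne)
        fun S' hS' => h S' (hS'.trans sdiff_subset)
      refine ⟨q + 1, ?_, ?_⟩
      · have := card_sdiff_add_card_eq_card hXP
        rw [add_mul, one_mul]
        omega
      · have := (sumColorable_one hXA).union hc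
        rw [union_sdiff_of_subset hXP] at this
        exact this.mono (by omega)

theorem injective_of_mem_genericTuples {S : Finset G} {k : ℕ} (hk : 3 ≤ k) {x : Fin k → G}
    (hx : x ∈ genericTuples S k) : Function.Injective x := by
  have hinj : Set.InjOn (fun p : Fin k × Fin k => x p.1 + x p.2) (orderedPairs k) :=
    card_image_iff.1 (mem_filter.1 hx).2
  have hsum : ∀ a c : Fin k, x (min a c) + x (max a c) = x a + x c := fun a c => by
    rcases le_total a c with h | h
    · rw [min_eq_left h, max_eq_right h]
    · rw [min_eq_right h, max_eq_left h, add_comm]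
  intro a b hab
  by_contra hne
  obtain ⟨c, hc⟩ : ∃ c : Fin k, c ∉ ({a, b} : Finset (Fin k)) := by
    by_contra! hall
    have h1 : #(univ : Finset (Fin k)) ≤ #({a, b} : Finset (Fin k)) :=
      card_le_card fun c _ => hall c
    have h2 := card_le_two (a := a) (b := b)
    rw [card_univ, Fintype.card_fin] at h1
    omega
  simp only [mem_insert, mem_singleton, not_or] at hc
  have hmem : ∀ a, c ≠ a → (min a c, max a c) ∈ orderedPairs k := fun a h =>
    mem_orderedPairs.2 (min_lt_max.2 h.symm)
  have heq := hinj (mem_coe.2 (hmem a hc.1)) (mem_coe.2 (hmem b hc.2))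
    (by simp only [hsum, hab])
  simp only [Prod.mk.injEq] at heq
  rcases lt_or_gt_of_ne hc.1 with h | h <;> rcases lt_or_gt_of_ne hc.2 with h' | h'
  · rw [max_eq_left h.le, max_eq_left h'.le] at heq
    exact hne heq.2
  · rw [min_eq_right h.le, min_eq_left h'.le] at heq
    exact hc.2 heq.1
  · rw [min_eq_left h.le, min_eq_right h'.le] at heq
    exact hc.1 heq.1.symm
  · rw [min_eq_left h.le, min_eq_left h'.le] at heq
    exact hne heq.1

theorem exists_good_of_generic {A S : Finset G} {k : ℕ} (hk : 3 ≤ k) {x : Fin k → G}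
    (hx : x ∈ genericTuples S k) (hA : pairSums x ⊆ A) :
    ∃ X ⊆ S, #X = k ∧ ∀ u ∈ X, ∀ v ∈ X, u ≠ v → u + v ∈ A := by
  refine ⟨univ.image x, ?_, ?_, ?_⟩
  · intro u hu
    obtain ⟨i, -, rfl⟩ := mem_image.1 hu
    exact mem_tuplesIn.1 (mem_filter.1 hx).1 i
  · rw [card_image_of_injective _ (injective_of_mem_genericTuples hk hx), card_univ,
      Fintype.card_fin]
  · intro u hu v hv hne
    obtain ⟨i, -, rfl⟩ := mem_image.1 hu
    obtain ⟨j, -, rfl⟩ := mem_image.1 hv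
    have hij : i ≠ j := fun h => hne (congrArg x h)
    rcases lt_or_gt_of_ne hij with h | h
    · exact hA (mem_image.2 ⟨(i, j), mem_orderedPairs.2 h, rfl⟩)
    · exact hA (mem_image.2 ⟨(j, i), mem_orderedPairs.2 h, add_comm _ _⟩)

end Colouring

section Assembly

variable {G : Type*} [AddCommGroup G] [Fintype G] [DecidableEq G]

theorem card_pow_four_le (P : Finset G) : #P ^ 4 ≤ Fintype.card G * P.addEnergy P := by
  have h := le_card_add_mul_addEnergy P P
  calc #P ^ 4 = #P ^ 2 * #P ^ 2 := by ring
    _ ≤ _ := h.trans (Nat.mul_le_mul_right _ (card_le_univ _))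

open Classical in
/-- A set of small energy has, for most `A`, a good `k`-set in each of its `s`-subsets. -/
theorem card_not_rich_le (P : Finset G) (k s : ℕ) (W : ℝ) (hk : 3 ≤ k) (hs : 2 * k ^ 4 ≤ s)
    (hsW : s ≤ W) (hP : (P.addEnergy P : ℝ) ≤ W ^ 4 / Fintype.card G)
    (hr : ∀ r ∈ Icc 2 k, (2 : ℝ) ^ (r + 1).choose 2 * k ^ (4 * r) * (k * Fintype.card G) ≤
      (s : ℝ) ^ r) :
    (#{A : Finset G | ¬ ∀ S ⊆ P, #S = s →
        ∃ X ⊆ S, #X = k ∧ ∀ x ∈ X, ∀ y ∈ X, x ≠ y → x + y ∈ A} : ℝ) ≤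
      Real.exp W * (2 ^ Fintype.card G *
        Real.exp (-((s : ℝ) ^ 4 / (24 * k ^ 4 * (W ^ 4 / Fintype.card G))))) := by
  have hN : (0 : ℝ) < Fintype.card G := by
    have : 0 < Fintype.card G := Fintype.card_pos
    exact_mod_cast this
  have hW : 0 ≤ W := le_trans (by positivity) hsW
  have hPW : (#P : ℝ) ≤ W := by
    have h : (#P : ℝ) ^ 4 ≤ Fintype.card G * P.addEnergy P := by exact_mod_cast card_pow_four_le P
    have h' : (#P : ℝ) ^ 4 ≤ W ^ 4 := by
      refine h.trans ((mul_le_mul_of_nonneg_left hP hN.le).trans (le_of_eq ?_))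
      field_simp
    exact le_of_pow_le_pow_left₀ (by norm_num) hW h'
  have hsub : ({A : Finset G | ¬ ∀ S ⊆ P, #S = s →
        ∃ X ⊆ S, #X = k ∧ ∀ x ∈ X, ∀ y ∈ X, x ≠ y → x + y ∈ A} : Finset (Finset G)) ⊆
      (P.powerset.filter fun S => #S = s).biUnion fun S =>
        {A : Finset G | ∀ x ∈ genericTuples S k, ¬ pairSums x ⊆ A} := by
    intro A hA
    simp only [mem_filter, mem_univ, true_and, not_forall] at hA
    obtain ⟨S, hSP, hS, hno⟩ := hA
    rw [mem_biUnion]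
    refine ⟨S, mem_filter.2 ⟨mem_powerset.2 hSP, hS⟩, mem_filter.2 ⟨mem_univ _, ?_⟩⟩
    exact fun x hx hxA => hno (exists_good_of_generic hk hx hxA)
  have hcard : (#({A : Finset G | ¬ ∀ S ⊆ P, #S = s →
        ∃ X ⊆ S, #X = k ∧ ∀ x ∈ X, ∀ y ∈ X, x ≠ y → x + y ∈ A} : Finset (Finset G)) : ℝ) ≤
      ∑ S ∈ P.powerset.filter fun S => #S = s,
        (#{A : Finset G | ∀ x ∈ genericTuples S k, ¬ pairSums x ⊆ A} : ℝ) := by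
    exact_mod_cast (card_le_card hsub).trans card_biUnion_le
  refine hcard.trans ((sum_le_card_nsmul _ _ (2 ^ Fintype.card G *
        Real.exp (-((s : ℝ) ^ 4 / (24 * k ^ 4 * (W ^ 4 / Fintype.card G))))) fun S hS => ?_).trans ?_)
  · obtain ⟨hSP, hS⟩ := mem_filter.1 hS
    rw [mem_powerset] at hSP
    subst hS
    refine le_trans (le_of_eq (by congr!)) (card_no_generic_le S k (by omega) _ hs
      (le_trans (by exact_mod_cast addEnergy_mono hSP hSP) hP) ?_ hr)
    rw [mul_div_cancel₀ _ hN.ne']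
    exact pow_le_pow_left₀ (by positivity) hsW 4
  · rw [nsmul_eq_mul]
    refine mul_le_mul_of_nonneg_right ?_ (by positivity)
    calc ((#(P.powerset.filter fun S => #S = s) : ℕ) : ℝ) ≤ (2 : ℝ) ^ #P := by
          have := card_filter_le P.powerset fun S => #S = s
          rw [card_powerset] at this
          exact_mod_cast this
      _ ≤ Real.exp 1 ^ #P := by
          gcongr
          have := Real.add_one_le_exp (1 : ℝ)
          linarith
      _ = Real.exp #P := by rw [← Real.exp_nat_mul, mul_one]
      _ ≤ Real.exp W := Real.exp_le_exp.2 hPW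

theorem sum_card_large_energy_le {m : ℕ} (f : G → Fin m) (hm : 1 ≤ m)
    (hf : m ^ 3 * ∑ c, (fibre f c).addEnergy (fibre f c) ≤ 5 * Fintype.card G ^ 3)
    (W : ℝ) (hW : 0 < W) :
    ∑ c with ¬ ((fibre f c).addEnergy (fibre f c) : ℝ) ≤ W ^ 4 / Fintype.card G,
      (#(fibre f c) : ℝ) ≤ 10 * (Fintype.card G : ℝ) ^ 4 / (m ^ 3 * W ^ 3) := by
  have hN : (0 : ℝ) < Fintype.card G := by
    have : 0 < Fintype.card G := Fintype.card_pos
    exact_mod_cast this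
  have hm0 : (0 : ℝ) < m := by exact_mod_cast hm
  set N : ℝ := (Fintype.card G : ℝ) with hNdef
  have hf' : (m : ℝ) ^ 3 * ∑ c, ((fibre f c).addEnergy (fibre f c) : ℝ) ≤ 5 * N ^ 3 := by
    rw [hNdef]; exact_mod_cast hf
  have hterm : ∀ c ∈ univ.filter (fun c => ¬ ((fibre f c).addEnergy (fibre f c) : ℝ) ≤ W ^ 4 / N),
      (#(fibre f c) : ℝ) * W ^ 3 ≤ 2 * N * (fibre f c).addEnergy (fibre f c) := by
    intro c hc
    have hc := not_le.1 (mem_filter.1 hc).2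
    rw [div_lt_iff₀ hN] at hc
    have h4 : (#(fibre f c) : ℝ) ^ 4 ≤ N * (fibre f c).addEnergy (fibre f c) := by
      rw [hNdef]; exact_mod_cast card_pow_four_le (fibre f c)
    have hp0 : (0 : ℝ) ≤ #(fibre f c) := by positivity
    have hle : (#(fibre f c) : ℝ) * W ^ 3 ≤ (#(fibre f c) : ℝ) ^ 4 + W ^ 4 := by
      rcases le_total (#(fibre f c) : ℝ) W with h | h
      · have : (#(fibre f c) : ℝ) * W ^ 3 ≤ W * W ^ 3 := by gcongr
        nlinarith [pow_nonneg hp0 4]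
      · have : (#(fibre f c) : ℝ) * W ^ 3 ≤ (#(fibre f c) : ℝ) * (#(fibre f c) : ℝ) ^ 3 := by gcongr
        nlinarith [pow_nonneg hW.le 4]
    linarith
  rw [le_div_iff₀ (by positivity)]
  calc _ = (m : ℝ) ^ 3 * ∑ c with ¬ ((fibre f c).addEnergy (fibre f c) : ℝ) ≤ W ^ 4 / N,
        (#(fibre f c) : ℝ) * W ^ 3 := by rw [← sum_mul]; ring
    _ ≤ (m : ℝ) ^ 3 * ∑ c, 2 * N * ((fibre f c).addEnergy (fibre f c) : ℝ) := by
        gcongr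
        refine (sum_le_sum hterm).trans ?_
        exact sum_le_sum_of_subset_of_nonneg (filter_subset _ _) fun c _ _ => by positivity
    _ = 2 * N * ((m : ℝ) ^ 3 * ∑ c, ((fibre f c).addEnergy (fibre f c) : ℝ)) := by
        rw [← mul_sum]; ring
    _ ≤ 2 * N * (5 * N ^ 3) := by gcongr
    _ = _ := by ring

open Classical in
/-- For most `A`, the group has a colouring with few colours. -/
theorem card_not_sumColorable_le (k s m : ℕ) (W : ℝ) (hk : 3 ≤ k) (hs : 2 * k ^ 4 ≤ s)
    (hsW : s ≤ W) (hm : 1 ≤ m) (hmN : m ^ 3 ≤ Fintype.card G)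
    (hr : ∀ r ∈ Icc 2 k, (2 : ℝ) ^ (r + 1).choose 2 * k ^ (4 * r) * (k * Fintype.card G) ≤
      (s : ℝ) ^ r) :
    (#{A : Finset G | ¬ ∃ n : ℕ, SumColorable A univ n ∧ (n : ℝ) ≤ (Fintype.card G : ℝ) / k +
        m * s + 10 * (Fintype.card G : ℝ) ^ 4 / (m ^ 3 * W ^ 3)} : ℝ) ≤
      m * (Real.exp W * (2 ^ Fintype.card G *
        Real.exp (-((s : ℝ) ^ 4 / (24 * k ^ 4 * (W ^ 4 / Fintype.card G)))))) := by
  have hW : 0 < W := by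
    have h1 : 0 < 2 * k ^ 4 := by positivity
    have h2 : (0 : ℝ) < s := by exact_mod_cast h1.trans_le hs
    linarith
  have hk0 : (0 : ℝ) < k := by exact_mod_cast (by omega : 0 < k)
  obtain ⟨f, hf⟩ := exists_fibres_small_energy (G := G) m hm hmN
  set good : Fin m → Prop := fun c =>
    ((fibre f c).addEnergy (fibre f c) : ℝ) ≤ W ^ 4 / Fintype.card G with hgood
  set rich : Finset G → Fin m → Prop := fun A c => ∀ S ⊆ fibre f c, #S = s →
    ∃ X ⊆ S, #X = k ∧ ∀ x ∈ X, ∀ y ∈ X, x ≠ y → x + y ∈ A with hrich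
  have hcol : ∀ A : Finset G, (∀ c, good c → rich A c) → ∃ n : ℕ, SumColorable A univ n ∧
      (n : ℝ) ≤ (Fintype.card G : ℝ) / k + m * s +
        10 * (Fintype.card G : ℝ) ^ 4 / (m ^ 3 * W ^ 3) := by
    intro A hA
    have hone : ∀ c, ∃ n : ℕ, SumColorable A (fibre f c) n ∧
        (n : ℝ) ≤ (#(fibre f c) : ℝ) / k + s + if ¬ good c then (#(fibre f c) : ℝ) else 0 := by
      intro c
      by_cases hc : good c
      · obtain ⟨q, hq, hcol⟩ := sumColorable_greedy (by omega) (fibre f c) (hA c hc)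
        refine ⟨q + s, hcol, ?_⟩
        have : (q : ℝ) ≤ (#(fibre f c) : ℝ) / k := by
          rw [le_div_iff₀ hk0]; exact_mod_cast hq
        push_cast
        simp only [hc, not_true_eq_false, if_false]
        linarith
      · refine ⟨_, sumColorable_card A _, ?_⟩
        simp only [hc, not_false_eq_true, if_true]
        have : 0 ≤ (#(fibre f c) : ℝ) / k + s := by positivity
        linarith
    choose n hn hnle using hone
    refine ⟨∑ c, n c, ?_, ?_⟩
    · have := sumColorable_biUnion univ (fibre f) n fun c _ => hn c
      convert this using 1
      ext x
      simp [fibre]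
    · push_cast
      refine (sum_le_sum fun c _ => hnle c).trans ?_
      rw [sum_add_distrib, sum_add_distrib, ← sum_div, sum_const, card_univ, Fintype.card_fin,
        nsmul_eq_mul, ← sum_filter]
      have hsum : ∑ c, (#(fibre f c) : ℝ) = Fintype.card G := by
        have : #(univ : Finset G) = ∑ c, #(fibre f c) :=
          card_eq_sum_card_fiberwise fun _ _ => mem_coe.2 (mem_univ _)
        rw [← card_univ, this, Nat.cast_sum]
      rw [hsum]
      refine add_le_add le_rfl (le_trans (le_of_eq ?_) (sum_card_large_energy_le f hm hf W hW))
      congr!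
  have hsub : ({A : Finset G | ¬ ∃ n : ℕ, SumColorable A univ n ∧
      (n : ℝ) ≤ (Fintype.card G : ℝ) / k + m * s +
        10 * (Fintype.card G : ℝ) ^ 4 / (m ^ 3 * W ^ 3)} : Finset (Finset G)) ⊆
      (univ.filter good).biUnion fun c => {A : Finset G | ¬ rich A c} := by
    intro A hA
    have hA : ¬ ∀ c, good c → rich A c := fun h => (mem_filter.1 hA).2 (hcol A h)
    simp only [not_forall] at hA
    obtain ⟨c, hc, hcA⟩ := hA
    exact mem_biUnion.2 ⟨c, mem_filter.2 ⟨mem_univ _, hc⟩, mem_filter.2 ⟨mem_univ _, hcA⟩⟩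
  have hcard : (#({A : Finset G | ¬ ∃ n : ℕ, SumColorable A univ n ∧
      (n : ℝ) ≤ (Fintype.card G : ℝ) / k + m * s +
        10 * (Fintype.card G : ℝ) ^ 4 / (m ^ 3 * W ^ 3)} : Finset (Finset G)) : ℝ) ≤
      ∑ c with good c, (#{A : Finset G | ¬ rich A c} : ℝ) := by
    exact_mod_cast (card_le_card hsub).trans card_biUnion_le
  refine hcard.trans ((sum_le_card_nsmul _ _ _ fun c hc =>
    card_not_rich_le (fibre f c) k s W hk hs hsW (mem_filter.1 hc).2 hr).trans ?_)
  rw [nsmul_eq_mul]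
  refine mul_le_mul_of_nonneg_right ?_ (by positivity)
  have : #(univ.filter good) ≤ m := (card_le_univ _).trans (by simp)
  exact_mod_cast this

end Assembly

theorem two_pow_choose_two (r : ℕ) :
    (2 : ℝ) ^ (r + 1).choose 2 = ((2 : ℝ) ^ (((r : ℝ) + 1) / 2)) ^ r := by
  rw [← Real.rpow_natCast, ← Real.rpow_mul_natCast (by norm_num), Nat.cast_choose_two]
  congr 1
  push_cast
  ring

theorem rank_condition {η l s : ℝ} {k r R : ℕ} (hη : 0 < η) (hη1 : η ≤ 1) (hR : 8 / η ≤ R)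
    (hl : 64 * 2 ^ R ≤ l) (hl128 : 128 ≤ l) (hpow : l ^ 25 ≤ 2 ^ (η * l / 4))
    (hk : (k : ℝ) ≤ (2 - η) * l) (hs : 2 ^ l / (4 * l ^ 20) ≤ s) (hr2 : 2 ≤ r) (hrk : r ≤ k) :
    (2 : ℝ) ^ (r + 1).choose 2 * k ^ (4 * r) * (k * 2 ^ l) ≤ s ^ r := by
  have hl0 : 0 < l := by linarith
  have hrR : (r : ℝ) ≤ k := by exact_mod_cast hrk
  have hr2' : (2 : ℝ) ≤ r := by exact_mod_cast hr2
  have hk2 : (k : ℝ) ≤ 2 * l := by nlinarith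
  have hk0 : (0 : ℝ) < k := by linarith
  have hk4 : (k : ℝ) ^ 4 ≤ 16 * l ^ 4 := by
    calc (k : ℝ) ^ 4 ≤ (2 * l) ^ 4 := by gcongr
      _ = _ := by ring
  have hpow' : l ^ 25 ≤ 2 ^ (l / 4) := hpow.trans
    (Real.rpow_le_rpow_of_exponent_le one_le_two (by nlinarith))
  have hl25 : 2 * l ≤ 2 ^ (l / 4) := by
    refine le_trans ?_ hpow'
    calc 2 * l ≤ l ^ 24 * l := by
          gcongr
          calc (2 : ℝ) ≤ l := by linarith
            _ = l ^ 1 := (pow_one l).symm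
            _ ≤ l ^ 24 := pow_le_pow_right₀ (by linarith) (by norm_num)
      _ = l ^ 25 := by ring
  have key : ∀ u : ℝ, 0 ≤ u → (2 : ℝ) ^ (((r : ℝ) + 1) / 2) * k ^ 4 * u ≤ s →
      k * 2 ^ l ≤ u ^ r → (2 : ℝ) ^ (r + 1).choose 2 * k ^ (4 * r) * (k * 2 ^ l) ≤ s ^ r := by
    intro u hu h1 h2
    rw [two_pow_choose_two, pow_mul]
    calc _ ≤ ((2 : ℝ) ^ (((r : ℝ) + 1) / 2)) ^ r * (k ^ 4) ^ r * u ^ r := by gcongr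
      _ = ((2 : ℝ) ^ (((r : ℝ) + 1) / 2) * k ^ 4 * u) ^ r := by rw [mul_pow, mul_pow]
      _ ≤ s ^ r := by gcongr
  rcases lt_or_ge r R with hlt | hge
  · have hltR : (r : ℝ) + 1 ≤ R := by exact_mod_cast hlt
    refine key (2 ^ (3 * l / 4)) (by positivity) (le_trans ?_ hs) ?_
    · rw [le_div_iff₀ (by positivity)]
      have hb : (2 : ℝ) ^ (((r : ℝ) + 1) / 2) ≤ 2 ^ R := by
        rw [← Real.rpow_natCast]
        exact Real.rpow_le_rpow_of_exponent_le one_le_two (by linarith)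
      calc _ ≤ (2 : ℝ) ^ R * (16 * l ^ 4) * 2 ^ (3 * l / 4) * (4 * l ^ 20) := by gcongr
        _ = (64 * 2 ^ R) * l ^ 24 * 2 ^ (3 * l / 4) := by ring
        _ ≤ l * l ^ 24 * 2 ^ (3 * l / 4) := by gcongr
        _ = l ^ 25 * 2 ^ (3 * l / 4) := by ring
        _ ≤ 2 ^ (l / 4) * 2 ^ (3 * l / 4) := by gcongr
        _ = 2 ^ l := by rw [← Real.rpow_add two_pos]; congr 1; ring
    · have hk' : (k : ℝ) ≤ 2 ^ (l / 2) := by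
        refine (hk2.trans hl25).trans (Real.rpow_le_rpow_of_exponent_le one_le_two (by linarith))
      calc (k : ℝ) * 2 ^ l ≤ 2 ^ (l / 2) * 2 ^ l := by gcongr
        _ = (2 ^ (3 * l / 4)) ^ 2 := by
            rw [← Real.rpow_add two_pos, ← Real.rpow_mul_natCast two_pos.le]; congr 1
            push_cast; ring
        _ ≤ (2 ^ (3 * l / 4)) ^ r :=
            pow_le_pow_right₀ (Real.one_le_rpow one_le_two (by positivity)) hr2
  · have hRr : 8 / η ≤ r := hR.trans (by exact_mod_cast hge)
    rw [div_le_iff₀ hη] at hRr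
    refine key (2 ^ (η * l / 4)) (by positivity) (le_trans ?_ hs) ?_
    · rw [le_div_iff₀ (by positivity)]
      have hb : (2 : ℝ) ^ (((r : ℝ) + 1) / 2) ≤ 2 * 2 ^ (l - η * l / 2) := by
        have h : (2 : ℝ) * 2 ^ (l - η * l / 2) = 2 ^ (1 + (l - η * l / 2)) := by
          rw [Real.rpow_add two_pos, Real.rpow_one]
        rw [h]
        exact Real.rpow_le_rpow_of_exponent_le one_le_two (by linarith)
      calc _ ≤ 2 * (2 : ℝ) ^ (l - η * l / 2) * (16 * l ^ 4) * 2 ^ (η * l / 4) * (4 * l ^ 20) := by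
            gcongr
        _ = 128 * l ^ 24 * (2 ^ (η * l / 4) * (2 : ℝ) ^ (l - η * l / 2)) := by ring
        _ ≤ l * l ^ 24 * (2 ^ (η * l / 4) * (2 : ℝ) ^ (l - η * l / 2)) := by gcongr
        _ = l ^ 25 * (2 ^ (η * l / 4) * (2 : ℝ) ^ (l - η * l / 2)) := by ring
        _ ≤ 2 ^ (η * l / 4) * (2 ^ (η * l / 4) * (2 : ℝ) ^ (l - η * l / 2)) := by gcongr
        _ = 2 ^ l := by rw [← Real.rpow_add two_pos, ← Real.rpow_add two_pos]; congr 1; ring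
    · have hk' : (k : ℝ) ≤ 2 ^ l := by
        refine (hk2.trans hl25).trans (Real.rpow_le_rpow_of_exponent_le one_le_two (by linarith))
      calc (k : ℝ) * 2 ^ l ≤ 2 ^ l * 2 ^ l := by gcongr
        _ = 2 ^ (2 * l) := by rw [← Real.rpow_add two_pos]; congr 1; ring
        _ ≤ 2 ^ (η * l / 4 * r) := Real.rpow_le_rpow_of_exponent_le one_le_two (by nlinarith)
        _ = (2 ^ (η * l / 4)) ^ r := Real.rpow_mul_natCast two_pos.le _ _

theorem failure_bound {l N m s k δ W : ℝ} (hl : 12288 ≤ l) (hδ : 24576 ≤ δ * l)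
    (hN : l ^ 35 ≤ N) (hm1 : l ^ 18 ≤ m) (hm2 : m ≤ 2 * l ^ 18) (hs : N / (2 * m * l ^ 2) ≤ s)
    (hk0 : 0 < k) (hk : k ≤ 2 * l) (hW : W = l * N / m) :
    m * (Real.exp W * Real.exp (-(s ^ 4 / (24 * k ^ 4 * (W ^ 4 / N))))) ≤ δ := by
  have hl0 : 0 < l := by linarith
  have hN0 : 0 < N := lt_of_lt_of_le (by positivity) hN
  have hm0 : 0 < m := lt_of_lt_of_le (by positivity) hm1
  have hW0 : 0 < W := by rw [hW]; positivity
  set x := N / (12288 * l ^ 16) with hx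
  have hx0 : 0 < x := by positivity
  have hWx : W ≤ x := by
    rw [hW, hx, div_le_div_iff₀ hm0 (by positivity)]
    calc l * N * (12288 * l ^ 16) ≤ l * N * (l * l ^ 16) := by gcongr
      _ = N * l ^ 18 := by ring
      _ ≤ N * m := by gcongr
  have hsx : 2 * x ≤ s ^ 4 / (24 * k ^ 4 * (W ^ 4 / N)) := by
    rw [le_div_iff₀ (by positivity)]
    calc 2 * x * (24 * k ^ 4 * (W ^ 4 / N)) ≤ 2 * x * (24 * (2 * l) ^ 4 * (W ^ 4 / N)) := by gcongr
      _ = (N / (2 * m * l ^ 2)) ^ 4 := by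
          rw [hx, hW]; field_simp; norm_num
      _ ≤ s ^ 4 := by gcongr
  have hexp : Real.exp W * Real.exp (-(s ^ 4 / (24 * k ^ 4 * (W ^ 4 / N)))) ≤ x⁻¹ := by
    rw [← Real.exp_add]
    calc _ ≤ Real.exp (-x) := Real.exp_le_exp.2 (by linarith)
      _ = (Real.exp x)⁻¹ := Real.exp_neg x
      _ ≤ x⁻¹ := by
          gcongr
          have := Real.add_one_le_exp x
          linarith
  calc _ ≤ (2 * l ^ 18) * x⁻¹ := by gcongr
    _ = 24576 * l ^ 34 / N := by rw [hx]; field_simp; norm_num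
    _ ≤ δ := by
        rw [div_le_iff₀ hN0]
        have hδ0 : 0 < δ := by
          by_contra! h
          nlinarith
        calc 24576 * l ^ 34 ≤ δ * l * l ^ 34 := by gcongr
          _ = δ * l ^ 35 := by ring
          _ ≤ δ * N := by gcongr

theorem colour_bound {ε η l N k : ℝ} (hη : 0 < η) (hη4 : η ≤ 1 / 4) (hηε : η ≤ ε / 4)
    (hl : 1 ≤ l) (hlε : 44 ≤ ε * l) (hlη : 1 ≤ η * l) (hN : 0 < N) (hk : (2 - η) * l - 1 ≤ k) :
    N / k + N / l ^ 2 + 10 * N / l ^ 3 ≤ (1 + ε) * (N / (2 * l)) := by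
  have hl0 : 0 < l := by linarith
  have hk' : (2 - 2 * η) * l ≤ k := by nlinarith
  have hp : 0 < 2 - 2 * η := by linarith
  have h1 : N / k ≤ (1 / 2 + η) * (N / l) := by
    calc N / k ≤ N / ((2 - 2 * η) * l) := by gcongr
      _ = (1 / (2 - 2 * η)) * (N / l) := by field_simp
      _ ≤ (1 / 2 + η) * (N / l) := by
          gcongr
          rw [div_le_iff₀ hp]
          nlinarith
  have h2 : N / l ^ 2 = (1 / l) * (N / l) := by field_simp
  have h3 : 10 * N / l ^ 3 ≤ (10 / l) * (N / l) := by
    rw [div_mul_div_comm, ← sq]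
    gcongr
    norm_num
  have h4 : 11 / l ≤ ε / 4 := by rw [div_le_iff₀ hl0]; linarith
  have hNl : 0 < N / l := by positivity
  have h5 : (1 + ε) * (N / (2 * l)) = (1 / 2 + ε / 2) * (N / l) := by field_simp
  have h6 : (1 / l) * (N / l) + (10 / l) * (N / l) = 11 / l * (N / l) := by ring
  have h7 : 11 / l * (N / l) ≤ ε / 4 * (N / l) := by gcongr
  have h8 : η * (N / l) ≤ ε / 4 * (N / l) := by gcongr
  rw [h5, h2]
  nlinarith

theorem exists_parameters {ε δ : ℝ} (hε : 0 < ε) (hδ : 0 < δ) : ∃ N₀ : ℕ, ∀ N : ℕ, N₀ ≤ N →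
    (1 + ε) * ((N : ℝ) / (2 * Real.logb 2 N)) ≤ N ∧
    ∃ (k s m : ℕ) (W : ℝ), 3 ≤ k ∧ 2 * k ^ 4 ≤ s ∧ s ≤ W ∧ 1 ≤ m ∧ m ^ 3 ≤ N ∧
      (∀ r ∈ Icc 2 k, (2 : ℝ) ^ (r + 1).choose 2 * k ^ (4 * r) * (k * N) ≤ (s : ℝ) ^ r) ∧
      (N : ℝ) / k + m * s + 10 * (N : ℝ) ^ 4 / (m ^ 3 * W ^ 3) ≤
        (1 + ε) * ((N : ℝ) / (2 * Real.logb 2 N)) ∧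
      m * (Real.exp W * Real.exp (-((s : ℝ) ^ 4 / (24 * k ^ 4 * (W ^ 4 / N))))) ≤ δ := by
  set η : ℝ := min (1 / 4) (ε / 4) with hηdef
  have hη : 0 < η := by positivity
  have hη4 : η ≤ 1 / 4 := min_le_left _ _
  have hηε : η ≤ ε / 4 := min_le_right _ _
  obtain ⟨R, hR⟩ := exists_nat_ge (8 / η)
  have hev : ∀ᶠ l : ℝ in Filter.atTop, l ^ 25 ≤ 2 ^ (η * l / 4) := by
    have hb : 0 < η / 4 * Real.log 2 := mul_pos (by positivity) (Real.log_pos one_lt_two)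
    have := (isLittleO_pow_exp_pos_mul_atTop (k := 25) hb).bound one_pos
    filter_upwards [this] with l hl
    rw [one_mul, Real.norm_of_nonneg (Real.exp_pos _).le] at hl
    refine (le_abs_self _).trans (hl.trans (le_of_eq ?_))
    rw [Real.rpow_def_of_pos two_pos]
    congr 1; ring
  have hlog : Filter.Tendsto (fun N : ℕ => Real.logb 2 (N : ℝ)) Filter.atTop Filter.atTop :=
    (Real.tendsto_logb_atTop one_lt_two).comp tendsto_natCast_atTop_atTop
  have hall := hlog.eventually (hev.and ((Filter.eventually_ge_atTop (64 * 2 ^ R)).and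
    ((Filter.eventually_ge_atTop 12288).and ((Filter.eventually_ge_atTop (24576 / δ)).and
    ((Filter.eventually_ge_atTop (44 / ε)).and ((Filter.eventually_ge_atTop (1 / η)).and
    (Filter.eventually_ge_atTop (1 + ε))))))))
  obtain ⟨N₀, hN₀⟩ := Filter.eventually_atTop.1 (hall.and (Filter.eventually_ge_atTop 1))
  refine ⟨N₀, fun N hN => ?_⟩
  obtain ⟨⟨hpow, hlR, hl, hlδ, hlε, hlη, hl1ε⟩, hN1⟩ := hN₀ N hN
  set l := Real.logb 2 (N : ℝ) with hldef
  have hl0 : 0 < l := by linarith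
  have hNpos : (0 : ℝ) < N := by exact_mod_cast hN1
  have hNl : (2 : ℝ) ^ l = N := Real.rpow_logb two_pos (by norm_num) hNpos
  rw [div_le_iff₀ hδ] at hlδ
  rw [div_le_iff₀ hε] at hlε
  rw [div_le_iff₀ hη] at hlη
  have hN100 : l ^ 100 ≤ N := by
    have h1 : l ^ 25 ≤ 2 ^ (l / 4) := hpow.trans
      (Real.rpow_le_rpow_of_exponent_le one_le_two (by nlinarith))
    calc l ^ 100 = (l ^ 25) ^ 4 := by ring
      _ ≤ (2 ^ (l / 4)) ^ 4 := by gcongr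
      _ = 2 ^ l := by
          rw [← Real.rpow_mul_natCast two_pos.le]; congr 1; push_cast; ring
      _ = N := hNl
  have hlN : ∀ a : ℕ, a ≤ 100 → l ^ a ≤ N := fun a ha =>
    (pow_le_pow_right₀ (by linarith) ha).trans hN100
  refine ⟨?_, ?_⟩
  · rw [mul_div_assoc', div_le_iff₀ (by positivity)]
    nlinarith
  set m := ⌈l ^ 18⌉₊ with hm
  have hm1 : l ^ 18 ≤ m := Nat.le_ceil _
  have hm2 : (m : ℝ) ≤ 2 * l ^ 18 := by
    have h := (Nat.ceil_lt_add_one (by positivity : (0 : ℝ) ≤ l ^ 18)).le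
    have h1 : 1 ≤ l ^ 18 := one_le_pow₀ (by linarith)
    linarith
  have hm0 : (0 : ℝ) < m := lt_of_lt_of_le (by positivity) hm1
  set k := ⌊(2 - η) * l⌋₊ with hk
  have hk1 : (k : ℝ) ≤ (2 - η) * l := Nat.floor_le (mul_nonneg (by linarith) hl0.le)
  have hk2 : (2 - η) * l - 1 ≤ k := (Nat.sub_one_lt_floor _).le
  have hk3 : (3 : ℝ) ≤ k := by nlinarith
  have hk2l : (k : ℝ) ≤ 2 * l := by nlinarith
  set s := ⌊(N : ℝ) / (m * l ^ 2)⌋₊ with hs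
  have hs1 : (s : ℝ) ≤ N / (m * l ^ 2) := Nat.floor_le (by positivity)
  have hbig : 2 * (m * l ^ 2) ≤ N := by
    calc 2 * (m * l ^ 2) ≤ 2 * (2 * l ^ 18 * l ^ 2) := by gcongr
      _ = 4 * l ^ 20 := by ring
      _ ≤ l * l ^ 20 := by gcongr; linarith
      _ = l ^ 21 := by ring
      _ ≤ N := hlN 21 (by norm_num)
  have hs2 : (N : ℝ) / (2 * m * l ^ 2) ≤ s := by
    have h1 := (Nat.sub_one_lt_floor ((N : ℝ) / (m * l ^ 2))).le
    have h2 : 2 ≤ (N : ℝ) / (m * l ^ 2) := by rw [le_div_iff₀ (by positivity)]; exact hbig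
    have h3 : (N : ℝ) / (2 * m * l ^ 2) = N / (m * l ^ 2) / 2 := by field_simp
    rw [h3]
    linarith
  have hs3 : (2 : ℝ) ^ l / (4 * l ^ 20) ≤ s := by
    refine le_trans ?_ hs2
    rw [hNl]
    refine div_le_div_of_nonneg_left hNpos.le (by positivity) ?_
    calc 2 * m * l ^ 2 ≤ 2 * (2 * l ^ 18) * l ^ 2 := by gcongr
      _ = 4 * l ^ 20 := by ring
  refine ⟨k, s, m, l * N / m, by exact_mod_cast hk3, ?_, ?_, ?_, ?_, ?_, ?_, ?_⟩
  · have : (2 : ℝ) * k ^ 4 ≤ s := by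
      refine le_trans ?_ hs3
      rw [hNl, le_div_iff₀ (by positivity)]
      calc 2 * (k : ℝ) ^ 4 * (4 * l ^ 20) ≤ 2 * (2 * l) ^ 4 * (4 * l ^ 20) := by gcongr
        _ = 128 * l ^ 24 := by ring
        _ ≤ l * l ^ 24 := by gcongr; linarith
        _ = l ^ 25 := by ring
        _ ≤ N := hlN 25 (by norm_num)
    exact_mod_cast this
  · refine hs1.trans ?_
    rw [div_le_div_iff₀ (by positivity) hm0]
    have : 1 ≤ l * l ^ 2 := by nlinarith [sq_nonneg l]
    calc (N : ℝ) * m = N * m * 1 := by ring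
      _ ≤ N * m * (l * l ^ 2) := by gcongr
      _ = _ := by ring
  · exact_mod_cast (by exact_mod_cast hm0 : 0 < m)
  · have : (m : ℝ) ^ 3 ≤ N := by
      calc (m : ℝ) ^ 3 ≤ (2 * l ^ 18) ^ 3 := by gcongr
        _ = 8 * l ^ 54 := by ring
        _ ≤ l * l ^ 54 := by gcongr; linarith
        _ = l ^ 55 := by ring
        _ ≤ N := hlN 55 (by norm_num)
    exact_mod_cast this
  · intro r hr
    rw [← hNl]
    exact rank_condition hη (by linarith) hR hlR (by linarith) hpow hk1 hs3 (mem_Icc.1 hr).1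
      (mem_Icc.1 hr).2
  · refine le_trans ?_ (colour_bound hη hη4 hηε (by linarith) (by linarith) (by linarith) hNpos hk2)
    have h1 : (m : ℝ) * s ≤ N / l ^ 2 := by
      calc (m : ℝ) * s ≤ m * (N / (m * l ^ 2)) := by gcongr
        _ = _ := by field_simp
    have h2 : 10 * (N : ℝ) ^ 4 / (m ^ 3 * (l * N / m) ^ 3) = 10 * N / l ^ 3 := by field_simp
    rw [h2]
    linarith
  · exact failure_bound hl (by linarith) (hlN 35 (by norm_num)) hm1 hm2 hs2 (by linarith) hk2l rfl

theorem le_randomSubsetProb {G : Type*} [Fintype G] (δ : ℝ) (E : Set (Set G))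
    (B : Finset (Finset G)) (hB : (#B : ℝ) ≤ δ * 2 ^ Fintype.card G)
    (hE : ∀ A : Finset G, A ∉ B → (A : Set G) ∈ E) : 1 - δ ≤ randomSubsetProb E := by
  classical
  have hcard : #Bᶜ ≤ Fintype.card E := by
    rw [← Fintype.card_coe]
    refine Fintype.card_le_of_injective
      (fun A : ↥(Bᶜ) => (⟨(A.1 : Set G), hE A.1 (mem_compl.1 A.2)⟩ : E)) fun A A' h => ?_
    exact Subtype.ext (coe_injective (congrArg Subtype.val h))
  have hc : #B + #Bᶜ = 2 ^ Fintype.card G := by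
    rw [card_add_card_compl, Fintype.card_finset]
  have hc' : (#B : ℝ) + #Bᶜ = 2 ^ Fintype.card G := by exact_mod_cast hc
  have hcard' : (#Bᶜ : ℝ) ≤ Fintype.card E := by exact_mod_cast hcard
  have hprob : randomSubsetProb E = (Fintype.card E : ℝ) / 2 ^ Fintype.card G := by
    rw [randomSubsetProb, PMF.toOuterMeasure_uniformOfFintype_apply, ENNReal.toReal_div]
    simp [Fintype.card_set]
  rw [hprob, le_div_iff₀ (by positivity)]
  linarith

/-- A map whose image has at most `r` elements is refined by a surjection onto `Fin r`. -/
theorem exists_surjective_refinement {α β : Type*} [Fintype α] [DecidableEq α] [DecidableEq β]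
    (g : α → β) (r : ℕ) (h1 : #(univ.image g) ≤ r) (h2 : r ≤ Fintype.card α) :
    ∃ h : α → Fin r, Function.Surjective h ∧ ∀ x y, h x = h y → g x = g y := by
  have hrep : ∀ b : univ.image g, ∃ x, g x = b := fun b => by
    obtain ⟨x, -, hx⟩ := mem_image.1 b.2
    exact ⟨x, hx⟩
  choose rep hrep using hrep
  have hcard : #(univ.image rep) ≤ r :=
    card_image_le.trans (by rw [card_univ, Fintype.card_coe]; exact h1)
  obtain ⟨R, hsub, -, hR⟩ := exists_subsuperset_card_eq (subset_univ (univ.image rep)) hcard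
    (by rwa [card_univ])
  set ρ : α → R := fun x => if hx : x ∈ R then ⟨x, hx⟩ else
    ⟨rep ⟨g x, mem_image_of_mem g (mem_univ x)⟩, hsub (mem_image_of_mem rep (mem_univ _))⟩ with hρ
  have hgρ : ∀ x, g (ρ x) = g x := fun x => by
    by_cases hx : x ∈ R
    · simp [hρ, hx]
    · simp [hρ, hx, hrep]
  refine ⟨fun x => (R.equivFinOfCardEq hR) (ρ x), fun i => ?_, fun x y hxy => ?_⟩
  · refine ⟨((R.equivFinOfCardEq hR).symm i : α), ?_⟩
    have : ρ ((R.equivFinOfCardEq hR).symm i : α) = (R.equivFinOfCardEq hR).symm i := by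
      simp [hρ]
    simp only [this, Equiv.apply_symm_apply]
  · have := (R.equivFinOfCardEq hR).injective hxy
    rw [← hgρ x, ← hgρ y, this]

section Conclusion

variable {G : Type*} [AddCommGroup G] [Fintype G]

theorem SumColorable.exists_partition {A : Finset G} {n r : ℕ} (h : SumColorable A univ n)
    (hn : n ≤ r) (hr : r ≤ Fintype.card G) :
    ∃ X : Fin r → Set G, IsPartitionInto r X ∧ ∀ i, restrictedSumset (X i) ⊆ (A : Set G) := by
  classical
  obtain ⟨c, hc, hA⟩ := h
  have himg : #(univ.image c) ≤ r := by
    refine le_trans (card_le_card (t := range n) fun b hb => ?_) (by simpa using hn)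
    obtain ⟨x, -, rfl⟩ := mem_image.1 hb
    exact mem_range.2 (hc x (mem_univ x))
  obtain ⟨f, hsurj, hf⟩ := exists_surjective_refinement c r himg hr
  refine ⟨fun i => f ⁻¹' {i}, ⟨fun i => ?_, fun i j hij => ?_, ?_⟩, fun i => ?_⟩
  · obtain ⟨x, hx⟩ := hsurj i
    exact ⟨x, hx⟩
  · exact Set.disjoint_left.2 fun x hx hx' => hij (hx.symm.trans hx')
  · exact Set.eq_univ_of_forall fun x => Set.mem_iUnion.2 ⟨f x, rfl⟩
  · rintro z ⟨x, hx, y, hy, hne, rfl⟩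
    exact mem_coe.2 (hA x (mem_univ x) y (mem_univ y) hne (hf x y (hx.trans hy.symm)))

theorem SumColorable.chromaticNumber_le [DecidableEq G] {A : Finset G} {n : ℕ}
    (h : SumColorable Aᶜ univ n) :
    ∃ k : ℕ, (cayleySumGraph (A : Set G)).chromaticNumber = (k : ℕ∞) ∧ k ≤ n := by
  obtain ⟨c, hc, hA⟩ := h
  have hcol : (cayleySumGraph (A : Set G)).Colorable n := by
    refine ⟨SimpleGraph.Coloring.mk (fun x => (⟨c x, hc x (mem_univ x)⟩ : Fin n)) ?_⟩
    intro x y hxy heq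
    have := hA x (mem_univ x) y (mem_univ y) hxy.1 (congrArg Fin.val heq)
    exact mem_compl.1 this (mem_coe.1 hxy.2)
  have hle := hcol.chromaticNumber_le
  obtain ⟨k, hk⟩ := ENat.ne_top_iff_exists.1 (ne_top_of_le_ne_top (ENat.natCast_ne_top n) hle)
  refine ⟨k, hk.symm, ?_⟩
  rw [← hk] at hle
  exact_mod_cast hle

end Conclusion

theorem theorem1p1 (ε : ℝ) (hε : 0 < ε) (δ : ℝ) (hδ : 0 < δ) :
    ∃ N₀ : ℕ, ∀ (G : Type*) [AddCommGroup G] [Fintype G],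
      N₀ ≤ Fintype.card G → Nat.Coprime (Fintype.card G) 6 →
        1 - δ ≤ randomSubsetProb {A : Set G | ∃ k : ℕ,
            (cayleySumGraph A).chromaticNumber = (k : ℕ∞) ∧
            (k : ℝ) ≤ (1 + ε) * ((Fintype.card G : ℝ) / (2 * Real.logb 2 (Fintype.card G)))} ∧
        1 - δ ≤ randomSubsetProb {A : Set G |
            ∃ X : Fin ⌊(1 + ε) * ((Fintype.card G : ℝ) /
                (2 * Real.logb 2 (Fintype.card G)))⌋₊ → Set G,
              IsPartitionInto _ X ∧ ∀ i, restrictedSumset (X i) ⊆ A} := by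
  classical
  obtain ⟨N₀, hN₀⟩ := exists_parameters hε hδ
  refine ⟨N₀, fun G _ _ hG _ => ?_⟩
  obtain ⟨hleN, k, s, m, W, hk, hs, hsW, hm, hmN, hr, hcolours, hfail⟩ := hN₀ _ hG
  set x := (1 + ε) * ((Fintype.card G : ℝ) / (2 * Real.logb 2 (Fintype.card G))) with hx
  set B : Finset (Finset G) := {A | ¬ ∃ n : ℕ, SumColorable A univ n ∧ (n : ℝ) ≤ x} with hBdef
  have hB : (#B : ℝ) ≤ δ * 2 ^ Fintype.card G := by
    have h := card_not_sumColorable_le (G := G) k s m W hk hs hsW hm hmN hr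
    have hsub : B ⊆ ({A : Finset G | ¬ ∃ n : ℕ, SumColorable A univ n ∧
        (n : ℝ) ≤ (Fintype.card G : ℝ) / k + m * s +
          10 * (Fintype.card G : ℝ) ^ 4 / (m ^ 3 * W ^ 3)} : Finset (Finset G)) := by
      intro A hA
      refine mem_filter.2 ⟨mem_univ _, fun ⟨n, hn, hnx⟩ => (mem_filter.1 hA).2 ?_⟩
      exact ⟨n, hn, hnx.trans hcolours⟩
    have hsub' : (#B : ℝ) ≤ _ := Nat.cast_le.2 (card_le_card hsub)
    refine hsub'.trans (h.trans ?_)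
    calc _ = m * (Real.exp W * Real.exp (-((s : ℝ) ^ 4 /
          (24 * k ^ 4 * (W ^ 4 / Fintype.card G))))) * 2 ^ Fintype.card G := by ring
      _ ≤ δ * 2 ^ Fintype.card G := by gcongr
  have hgood : ∀ A ∉ B, ∃ n : ℕ, SumColorable A univ n ∧ (n : ℝ) ≤ x := fun A hA => by
    by_contra h
    exact hA (mem_filter.2 ⟨mem_univ _, h⟩)
  refine ⟨le_randomSubsetProb δ _ (B.image compl) ?_ ?_, le_randomSubsetProb δ _ B hB ?_⟩
  · exact le_trans (Nat.cast_le.2 card_image_le) hB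
  · intro A hA
    have hA' : Aᶜ ∉ B := fun h => hA (mem_image.2 ⟨Aᶜ, h, compl_compl A⟩)
    obtain ⟨n, hn, hnx⟩ := hgood _ hA'
    obtain ⟨c, hc, hcn⟩ := hn.chromaticNumber_le
    exact ⟨c, hc, le_trans (Nat.cast_le.2 hcn) hnx⟩
  · intro A hA
    obtain ⟨n, hn, hnx⟩ := hgood _ hA
    refine hn.exists_partition (Nat.le_floor hnx) ?_
    exact Nat.floor_le_of_le hleN
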